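/- **Relativistic Chasles' theorem, causal Lie cone version.** *Setting.* Let $\eta=\mathrm{diag}(-1,1,1,1)$, indices running over $0,\dots,3$ and being raised and lowered with $\eta$. A vector $v\in\mathbb R^4$ is future directed (f.d.) timelike (resp. f.d. causal) if $\eta(v,v)<0$ (resp. $\le 0$) and $v^0>0$; it is f.d. nonspacelike if it is f.d. causal or zero. $I^+(q)$ is the set of points reached from $q$ along f.d. timelike curves; $J^+(q)$ is $q$ together with the points reached along f.d. causal curves. $SO(1,3)^\uparrow$ is the group of real $4\times4$ matrices $\Lambda$ with $\Lambda^{T}\eta\Lambda=\eta$, $\det\Lambda=1$, $\Lambda^0{}_0>0$; $ISO(1,3)^\uparrow$ is the group of matrices $\begin{pmatrix}\Lambda&-b\\0&1\end{pmatrix}$ with $\Lambda\in SO(1,3)^\uparrow$, $b\in\mathbb R^4$, and $I$ (resp. $J$) is its subset where $b$ is f.d. timelike (resp. f.d. nonspacelike). $\mathfrak{iso}(1,3)$ consists of the matrices $X=\begin{pmatrix}F&-w\\0&0\end{pmatrix}$ with $F_{ab}=-F_{ba}$; $ISO(1,3)^\uparrow$ acts on it by $\mathrm{Ad}$ (conjugation,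 i.e. change of reference frame). Matrices describe changes of coordinates, so that the flow of $X$ moves points by $q\mapsto\exp(sX)^{-1}\begin{pmatrix}q\\1\end{pmatrix}$; equivalently, it is the flow of the vector field $(-F^a{}_bx^b+w^a)\partial_a$. Write $\ln I$ (resp. $\ln J$) for the set of $X\in\mathfrak{iso}(1,3)$ with $\exp X\in I$ (resp. $J$). The generators are $J^{ab}$, with upper left block $(M^{ab})^c{}_d=\eta^{ac}\delta^b_d-\eta^{bc}\delta^a_d$ and zeros elsewhere, and $P^a$, with last column $(\eta^{ac})_c$ above $0$ and zeros elsewhere; $H=P^0$, $K^i=J^{0i}$, $J^1=J^{23}$, $J^3=J^{12}$. With $\varepsilon_{0123}=1$ and $\tilde F_{cd}=\frac12\varepsilon_{abcd}F^{ab}$ put $$I_1=\tfrac14F_{ab}F^{ab},\quad I_2=-\tfrac14\tilde F_{ab}F^{ab},\quad I_3=\tilde F_{ab}w^b\tilde F^a{}_cw^c,\quad I_4=\inf_{c\in\mathbb R^4}\eta(w+Fc,w+Fc)$$ ($I_4$ is only used if $I_1=I_2=I_3=0$; $I_4=w^aw_a$ if $F=0$). **Theorem.** Let $X\in\mathfrak{iso}(1,3)$.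 **(0)** The flow of $X$ sends some point $q$ into $I^+(q)$ for some $s>0$ if and only if the Ad-orbit of $X$ meets $\ln I$. It sends some point $q$ into $J^+(q)\setminus\{q\}$ for some $s>0$ if and only if the Ad-orbit of $X$ contains some $Y\in\ln J$ such that $\exp Y$ has nonzero translational part $b$. **(1)** Let $X\neq0$, and suppose that its flow sends some point $q$ into $I^+(q)$ for some $s>0$. - If $I_2\ne0$, then $X$ is Ad-conjugate to (a) $\tau(aK^1+\omega J^1+H)$ for some $a>0$, $\omega\neq0$, $\tau>0$. The triples $(a,\omega,\tau)$ in this range that occur are exactly those with $(a^2-\omega^2)\tau^2=-2I_1$ and $a\omega\tau^2=I_2$. - If $I_2=0$, then $X$ is Ad-conjugate to (b) $\tau(aK^2-\omega J^3+H)$ for some $a\ge0$, $\omega\ge0$, $\tau>0$. The triples $(a,\omega,\tau)$ in this range that occur are exactly those with $(a^2-\omega^2)\tau^2=-2I_1$, $\omega^2\tau^4=I_3$ and, if $I_1=I_3=0$, also $\tau^2=-I_4$. If $I_1\le0$, one can take $0\le\omega\le a$; if $I_1>0$, then $I_3>0$ and one can take $a=0$, $\omega=2I_1/\sqrt{I_3}$.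 - $I_1=I_2=I_3=0$ if and only if $F=0$. - Say that $X$ is a pure rotation if it is Ad-conjugate to a form (b) with $a=0$. This holds if and only if $I_2=0$ and $I_1>0$, or $I_1=I_2=I_3=0$. - If $X$ is not a pure rotation, then for every $\tau>0$ there are $a,\omega$ such that $X$ is Ad-conjugate to a form (a) or (b) with constants $a,\omega,\tau$ in the ranges above, and $a$ and $|\omega|$ are uniquely determined by $\tau$. **(2)** Suppose that the flow of $X$ sends some point $q$ into $J^+(q)\setminus\{q\}$ for some $s>0$, but sends no point $q$ into $I^+(q)$ for any $s>0$. Then $I_1\ge0$, and: - If $I_1>0$ or $F=0$, there is $\epsilon_2\in\{1,-1\}$ such that $X$ is Ad-conjugate to (c) $(\omega J^1-\epsilon_2P^1+H)\lambda$ for some $\omega\ge0$, $\lambda>0$; for this $\epsilon_2$, the pairs $\omega\ge0$, $\lambda>0$ that occur are exactly those with $\lambda\omega=\sqrt{2I_1}$. - If $I_1=0$ and $F\neq0$, then $X$ is Ad-conjugate to (d) $((K^2-J^3)\eta-P^1+H)\lambda$ for all real $\eta\neq0$ and $\lambda>0$ (here $\eta$ denotes a number). -/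

import Mathlib

open Set

namespace MinkowskiSpace

/-- Coordinate vectors `(x⁰, x¹, x², x³)`; a fixed reference frame identifies both Minkowski
spacetime `M` and its space of translations with this space. -/
abbrev Vec4 : Type := Fin 4 → ℝ

/-- `4 × 4` real matrices, with entries `F a b` standing for `F^a_b`. -/
abbrev Mat4 : Type := Matrix (Fin 4) (Fin 4) ℝ

/-- `5 × 5` real matrices, split into a `4 × 4` block, a last column and a last row. -/
abbrev Mat5 : Type := Matrix (Fin 4 ⊕ Unit) (Fin 4 ⊕ Unit) ℝ

/-- The matrix `η_{ab}` of the Minkowski metric, signature `(-,+,+,+)`. It is its own inverse, so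
it is also `η^{ab}`. -/
def eta : Mat4 := Matrix.diagonal ![-1, 1, 1, 1]

/-- The Minkowski inner product `η(v, w) = η_{ab} v^a w^b`. -/
def ip (v w : Vec4) : ℝ := v ⬝ᵥ (eta.mulVec w)

/-- Future directed timelike vectors. -/
def FDTimelike (v : Vec4) : Prop := ip v v < 0 ∧ 0 < v 0

/-- Future directed causal vectors (nonzero, timelike or lightlike). -/
def FDCausal (v : Vec4) : Prop := ip v v ≤ 0 ∧ 0 < v 0

/-- Future directed nonspacelike vectors: causal, or zero. -/
def FDNonspacelike (v : Vec4) : Prop := FDCausal v ∨ v = 0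

/-- The chronological future `I⁺(x)`: the points that can be reached from `x` along a future
directed timelike curve. -/
def chronFuture (x : Vec4) : Set Vec4 :=
  {y | ∃ γ : ℝ → Vec4, ContDiffOn ℝ 1 γ (Icc 0 1) ∧
    (∀ t ∈ Icc (0 : ℝ) 1, FDTimelike (derivWithin γ (Icc 0 1) t)) ∧ γ 0 = x ∧ γ 1 = y}

/-- The causal future `J⁺(x)`: the point `x` and the points that can be reached from `x` along a
future directed causal curve. -/
def causalFuture (x : Vec4) : Set Vec4 :=
  {x} ∪ {y | ∃ γ : ℝ → Vec4, ContDiffOn ℝ 1 γ (Icc 0 1) ∧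
    (∀ t ∈ Icc (0 : ℝ) 1, FDCausal (derivWithin γ (Icc 0 1) t)) ∧ γ 0 = x ∧ γ 1 = y}

/-- The proper orthochronous Lorentz group `SO(1,3)↑`. -/
def SO13 : Set Mat4 := {L | L.transpose * eta * L = eta ∧ L.det = 1 ∧ 0 < L 0 0}

/-- The Lie algebra `so(1,3)`: matrices `F^a_b` with `F_{ab} + F_{ba} = 0`, where
`F_{ab} = η_{ac} F^c_b`. -/
def so13 : Set Mat4 := {F | eta * F + (eta * F).transpose = 0}

/-- The matrix with blocks `Λ`, `-b`, `0`, `1`. -/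
def groupMat (L : Mat4) (b : Vec4) : Mat5 :=
  Matrix.fromBlocks L (-(Matrix.replicateCol Unit b)) 0 1

/-- The matrix with blocks `F`, `-w`, `0`, `0`. -/
def algMat (F : Mat4) (w : Vec4) : Mat5 :=
  Matrix.fromBlocks F (-(Matrix.replicateCol Unit w)) 0 0

/-- The proper orthochronous inhomogeneous Lorentz group `ISO(1,3)↑`. -/
def ISO13 : Set Mat5 := {g | ∃ L ∈ SO13, ∃ b : Vec4, g = groupMat L b}

/-- The Lie algebra `iso(1,3)`. -/
def iso13 : Set Mat5 := {X | ∃ F ∈ so13, ∃ w : Vec4, X = algMat F w}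

/-- The homogeneous part: `F` for the matrix with blocks `F`, `-w`. -/
def linPart (X : Mat5) : Mat4 := X.toBlocks₁₁

/-- The translational part: `w` for the matrix with blocks `F`, `-w`. -/
def transPart (X : Mat5) : Vec4 := fun i => -X (Sum.inl i) (Sum.inr ())

/-- The orbit of `X` under the adjoint action of `ISO(1,3)↑`, that is, the matrix forms that the
same infinitesimal transformation takes in the various reference frames. -/
def adOrbit (X : Mat5) : Set Mat5 := {Y | ∃ g ∈ ISO13, Y = g * X * g⁻¹}

/-- The map of spacetime described by an element `g` of `ISO(1,3)↑`. The matrix `g` gives the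
change of coordinates `x' = Λ x - b` induced by dragging the reference frame along with the map
`P`, so that `P` itself acts on points by the inverse matrix; in particular it sends the origin to
`Λ⁻¹ b`. -/
noncomputable def pointMap (g : Mat5) (q : Vec4) : Vec4 :=
  fun i => (g⁻¹.mulVec (Sum.elim q (fun _ => 1))) (Sum.inl i)

/-- The flow `exp(s X)` on points of spacetime: the flow of the vector field
`(-F^a_b x^b + w^a) ∂_a` if `X` has blocks `F`, `-w`. -/
noncomputable def flow (X : Mat5) (s : ℝ) (q : Vec4) : Vec4 :=
  pointMap (NormedSpace.exp (s • X)) q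

/-- The flow of `X` sends some point to its timelike (chronological) future. -/
def MovesToTimelikeFuture (X : Mat5) : Prop :=
  ∃ q : Vec4, ∃ s : ℝ, 0 < s ∧ flow X s q ∈ chronFuture q

/-- The flow of `X` sends some point `q` to `J⁺(q) \ {q}`. -/
def MovesToCausalFuture (X : Mat5) : Prop :=
  ∃ q : Vec4, ∃ s : ℝ, 0 < s ∧ flow X s q ∈ causalFuture q \ {q}

/-- The timelike semigroup `I` of `ISO(1,3)↑`. -/
def semigroupI : Set Mat5 := {g | ∃ L ∈ SO13, ∃ b : Vec4, FDTimelike b ∧ g = groupMat L b}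

/-- The causal semigroup `J` of `ISO(1,3)↑`. -/
def semigroupJ : Set Mat5 := {g | ∃ L ∈ SO13, ∃ b : Vec4, FDNonspacelike b ∧ g = groupMat L b}

/-- `ln I`: the elements of `iso(1,3)` whose exponential lies in `I`. -/
def lnI : Set Mat5 := {X | X ∈ iso13 ∧ NormedSpace.exp X ∈ semigroupI}

/-- `ln J`: the elements of `iso(1,3)` whose exponential lies in `J`. -/
def lnJ : Set Mat5 := {X | X ∈ iso13 ∧ NormedSpace.exp X ∈ semigroupJ}

/-- `(M^{ab})^c_d = η^{ac} δ^b_d - η^{bc} δ^a_d`. -/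
def genM (a b : Fin 4) : Mat4 :=
  Matrix.of fun c d => eta a c * (if b = d then 1 else 0) - eta b c * (if a = d then 1 else 0)

/-- The generator `J^{ab}` of `iso(1,3)`. -/
def genJ (a b : Fin 4) : Mat5 := Matrix.fromBlocks (genM a b) 0 0 0

/-- The generator `P^a` of `iso(1,3)`, with last column `(m^a)^c = η^{ac}`. -/
def genP (a : Fin 4) : Mat5 := Matrix.fromBlocks 0 (Matrix.replicateCol Unit (eta a)) 0 0

/-- `H = P^0`. -/
def genH : Mat5 := genP 0

/-- `K^1 = J^{01}`. -/
def K1 : Mat5 := genJ 0 1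

/-- `K^2 = J^{02}`. -/
def K2 : Mat5 := genJ 0 2

/-- `J^1 = J^{23}`. -/
def J1 : Mat5 := genJ 2 3

/-- `J^3 = J^{12}`. -/
def J3 : Mat5 := genJ 1 2

/-- `P^1`. -/
def P1 : Mat5 := genP 1

/-- The form `τ (a K^1 + ω J^1 + H)`. -/
def formA (a ω τ : ℝ) : Mat5 := τ • (a • K1 + ω • J1 + genH)

/-- The form `τ (a K^2 - ω J^3 + H)`. -/
def formB (a ω τ : ℝ) : Mat5 := τ • (a • K2 - ω • J3 + genH)

/-- The form `(ω J^1 - ε₂ P^1 + H) l`. -/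
def formC (ε₂ ω l : ℝ) : Mat5 := l • (ω • J1 - ε₂ • P1 + genH)

/-- The form `((K^2 - J^3) h - P^1 + H) l`. -/
def formD (h l : ℝ) : Mat5 := l • (h • (K2 - J3) - P1 + genH)

/-- The Levi-Civita symbol `ε_{abcd}`, with `ε_{0123} = 1`: the determinant of the matrix with
rows `e_a, e_b, e_c, e_d`. -/
def leviCivita (a b c d : Fin 4) : ℝ :=
  Matrix.det (Matrix.of fun i j : Fin 4 => if ![a, b, c, d] i = j then (1 : ℝ) else 0)

/-- `F_{ab} = η_{ac} F^c_b`. -/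
def lower (F : Mat4) : Mat4 := eta * F

/-- `F^{ab} = F^a_c η^{cb}`. -/
def upper (F : Mat4) : Mat4 := F * eta

/-- The dual `F̃_{cd} = ½ ε_{abcd} F^{ab}`. -/
noncomputable def dual (F : Mat4) : Mat4 :=
  Matrix.of fun c d => (1 / 2) * ∑ a, ∑ b, leviCivita a b c d * upper F a b

/-- `I₁ = ¼ F_{ab} F^{ab}`. -/
noncomputable def I₁ (X : Mat5) : ℝ :=
  (1 / 4) * ∑ a, ∑ b, lower (linPart X) a b * upper (linPart X) a b

/-- `I₂ = -¼ F̃_{ab} F^{ab} = -⅛ ε_{abcd} F^{ab} F^{cd}`, normalized so that `I₂ = φ θ` for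
`φ K^1 + θ J^1`. -/
noncomputable def I₂ (X : Mat5) : ℝ :=
  -(1 / 4) * ∑ a, ∑ b, dual (linPart X) a b * upper (linPart X) a b

/-- `I₃ = F̃_{ab} w^b F̃^a_c w^c`, the Minkowski square of `F̃ w`; it is an invariant if
`I₂ = 0`. -/
noncomputable def I₃ (X : Mat5) : ℝ :=
  ip ((dual (linPart X)).mulVec (transPart X)) ((dual (linPart X)).mulVec (transPart X))

/-- `I₄`, the minimum of `w'^a w'_a` over the class `w + Im F`, used if `I₁ = I₂ = I₃ = 0`;
it is `w^a w_a` if `F = 0`. -/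
noncomputable def I₄ (X : Mat5) : ℝ :=
  sInf {r | ∃ c : Vec4, r = ip (transPart X + (linPart X).mulVec c)
    (transPart X + (linPart X).mulVec c)}

/-- In some reference frame `X` takes the form (a), `τ (a K^1 + ω J^1 + H)`, with `a > 0`,
`ω ≠ 0`, `τ > 0`. -/
def HasFormA (X : Mat5) (a ω τ : ℝ) : Prop :=
  0 < a ∧ ω ≠ 0 ∧ 0 < τ ∧ formA a ω τ ∈ adOrbit X

/-- In some reference frame `X` takes the form (b), `τ (a K^2 - ω J^3 + H)`, with `a, ω ≥ 0`,
`τ > 0`. -/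
def HasFormB (X : Mat5) (a ω τ : ℝ) : Prop :=
  0 ≤ a ∧ 0 ≤ ω ∧ 0 < τ ∧ formB a ω τ ∈ adOrbit X

/-- In some reference frame `X` takes the form (c), `(ω J^1 - ε₂ P^1 + H) l`, with `ω ≥ 0`,
`l > 0`. -/
def HasFormC (X : Mat5) (ε₂ ω l : ℝ) : Prop :=
  0 ≤ ω ∧ 0 < l ∧ formC ε₂ ω l ∈ adOrbit X

/-- In some reference frame `X` takes the form (d), `((K^2 - J^3) h - P^1 + H) l`, with `h ≠ 0`,
`l > 0`. -/
def HasFormD (X : Mat5) (h l : ℝ) : Prop :=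
  h ≠ 0 ∧ 0 < l ∧ formD h l ∈ adOrbit X

/-- Pure rotation: the frame can be chosen so that there is no acceleration, `a = 0`. -/
def IsPureRotation (X : Mat5) : Prop := ∃ ω τ : ℝ, HasFormB X 0 ω τ

end MinkowskiSpace

open MinkowskiSpace

namespace MinkowskiSpace

/-! A change of frame with Lorentz matrix M and translation c turns the pair (F, w) into (M⁻¹FM,
M⁻¹(w + Fc)), so only the class w + Im F of the translational part matters
(`algMat_mem_adOrbit_iff`).

The causal hypotheses are statements about this class. In flat spacetime y lies in the future of x
exactly when y - x lies in the future cone, by convexity of the cone (`exists_curve_iff`). A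
displacement along the flow is the integral of the field, hence s times an element of w + Im F
(`exists_displacement`). Conversely, the velocity along an orbit is transported by Lorentz matrices,
so once in the cone it stays there, and so does the displacement. Thus the flow moves some point
into its future if and only if w + Im F meets the cone (`flow_meets_iff`). Shifting the origin to a
suitable point gives the formulation with exponentials (`fieldMeets_iff_orbit`).

What remains is a classification of pairs, with F viewed as an electromagnetic field (e, b). The
numbers I₁ and I₂ are its two Lorentz invariants. If I₂ = 0 then the dual of F kills Im F, so I₃
depends only on the class of w. If I₂ ≠ 0, a frame makes e and b parallel, F is invertible and w can
be moved anywhere: form (a). If I₂ = 0 and the class is timelike, a rest frame of a timelike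
representative has e ⊥ b, and rotations give form (b); boosts orthogonal to e and b, followed by
translations, connect all forms (b) with the same invariants (`formB_mem_adOrbit_formB`).

If the class is causal but not timelike, then I₂ = 0, and I₁ < 0 is impossible, since the image of a
boost generator contains a timelike direction. For I₁ > 0 the matrix F rotates a spatial plane and w
reduces to a null vector orthogonal to it; F = 0 is similar: form (c). For I₁ = 0 and F ≠ 0, F is a
null rotation, and w must be orthogonal to its null direction: form (d). -/

/-! ### The Lorentz group and the causal cone. -/

theorem eta_mul_eta : eta * eta = 1 := by
  ext i j; fin_cases i <;> fin_cases j <;> simp [eta]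

theorem eta_transpose : eta.transpose = eta := by simp [eta]

theorem ip_eq (v w : Vec4) : ip v w = -(v 0 * w 0) + v 1 * w 1 + v 2 * w 2 + v 3 * w 3 := by
  simp [ip, eta, dotProduct, Fin.sum_univ_four, Matrix.mulVec_diagonal]

theorem ip_mulVec (L : Mat4) (h : L.transpose * eta * L = eta) (v w : Vec4) :
    ip (L.mulVec v) (L.mulVec w) = ip v w := by
  unfold ip
  rw [Matrix.mulVec_mulVec, ← Matrix.vecMul_transpose, ← Matrix.dotProduct_mulVec,
    Matrix.mulVec_mulVec, ← Matrix.mul_assoc, h]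

theorem lorentz_mul_inv {L : Mat4} (h : L.transpose * eta * L = eta) :
    L * (eta * L.transpose * eta) = 1 := by
  apply mul_eq_one_comm.mp
  rw [Matrix.mul_assoc eta, Matrix.mul_assoc, h, eta_mul_eta]

theorem lorentz_inv {L : Mat4} (h : L.transpose * eta * L = eta) :
    L⁻¹ = eta * L.transpose * eta := Matrix.inv_eq_right_inv (lorentz_mul_inv h)

theorem lorentz_isUnit_det {L : Mat4} (h : L.transpose * eta * L = eta) : IsUnit L.det :=
  Matrix.isUnit_det_of_right_inverse (lorentz_mul_inv h)

theorem lorentz_transpose {L : Mat4} (h : L.transpose * eta * L = eta) :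
    L * eta * L.transpose = eta := by
  have := congrArg (· * eta) (lorentz_mul_inv h)
  simpa [Matrix.mul_assoc, eta_mul_eta] using this

theorem lorentz_row_zero {L : Mat4} (h : L.transpose * eta * L = eta) :
    L 0 1 ^ 2 + L 0 2 ^ 2 + L 0 3 ^ 2 = L 0 0 ^ 2 - 1 := by
  have := congrFun (congrFun (lorentz_transpose h) 0) 0
  simp [eta, Matrix.mul_apply, Fin.sum_univ_four, Matrix.diagonal_apply] at this
  linarith

/-- By Cauchy–Schwarz the spatial part of row 0 contributes less than `L 0 0 * v 0` in absolute
value, because that row is a unit timelike vector. -/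
theorem time_component_pos {L : Mat4} (hL : L ∈ SO13) {v : Vec4} (hv : FDCausal v) :
    0 < (L.mulVec v) 0 := by
  obtain ⟨h, -, h0⟩ := hL
  obtain ⟨h1, h2⟩ := hv
  rw [ip_eq] at h1
  have hr := lorentz_row_zero h
  have key : (L 0 1 * v 1 + L 0 2 * v 2 + L 0 3 * v 3) ^ 2 < (L 0 0 * v 0) ^ 2 := by
    have c1 : (L 0 1 * v 1 + L 0 2 * v 2 + L 0 3 * v 3) ^ 2 ≤
        (L 0 1 ^ 2 + L 0 2 ^ 2 + L 0 3 ^ 2) * (v 1 ^ 2 + v 2 ^ 2 + v 3 ^ 2) := by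
      nlinarith [sq_nonneg (L 0 1 * v 2 - L 0 2 * v 1), sq_nonneg (L 0 1 * v 3 - L 0 3 * v 1),
        sq_nonneg (L 0 2 * v 3 - L 0 3 * v 2)]
    have c2 : (L 0 1 ^ 2 + L 0 2 ^ 2 + L 0 3 ^ 2) * (v 1 ^ 2 + v 2 ^ 2 + v 3 ^ 2) ≤
        (L 0 1 ^ 2 + L 0 2 ^ 2 + L 0 3 ^ 2) * v 0 ^ 2 :=
      mul_le_mul_of_nonneg_left (by nlinarith) (by positivity)
    rw [hr] at c1 c2
    nlinarith [pow_pos h2 2]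
  have := abs_lt_of_sq_lt_sq' key (by positivity)
  simp only [Matrix.mulVec, dotProduct, Fin.sum_univ_four]
  linarith [this.1]

theorem FDTimelike.causal {v : Vec4} (h : FDTimelike v) : FDCausal v := ⟨h.1.le, h.2⟩

theorem FDTimelike.mulVec {L : Mat4} (hL : L ∈ SO13) {v : Vec4} (hv : FDTimelike v) :
    FDTimelike (L.mulVec v) :=
  ⟨by rw [ip_mulVec L hL.1]; exact hv.1, time_component_pos hL hv.causal⟩

theorem FDCausal.mulVec {L : Mat4} (hL : L ∈ SO13) {v : Vec4} (hv : FDCausal v) :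
    FDCausal (L.mulVec v) :=
  ⟨by rw [ip_mulVec L hL.1]; exact hv.1, time_component_pos hL hv⟩

theorem FDTimelike.smul {s : ℝ} (hs : 0 < s) {v : Vec4} (hv : FDTimelike v) :
    FDTimelike (s • v) := by
  obtain ⟨h1, h2⟩ := hv
  rw [ip_eq] at h1
  refine ⟨?_, by simpa using mul_pos hs h2⟩
  rw [ip_eq]
  simp only [Pi.smul_apply, smul_eq_mul]
  nlinarith [pow_pos hs 2]

theorem FDCausal.smul {s : ℝ} (hs : 0 < s) {v : Vec4} (hv : FDCausal v) :
    FDCausal (s • v) := by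
  obtain ⟨h1, h2⟩ := hv
  rw [ip_eq] at h1
  refine ⟨?_, by simpa using mul_pos hs h2⟩
  rw [ip_eq]
  simp only [Pi.smul_apply, smul_eq_mul]
  nlinarith [pow_pos hs 2]

theorem SO13_mul {L M : Mat4} (hL : L ∈ SO13) (hM : M ∈ SO13) : L * M ∈ SO13 := by
  refine ⟨?_, by rw [Matrix.det_mul, hL.2.1, hM.2.1, one_mul], ?_⟩
  · rw [Matrix.transpose_mul, show M.transpose * L.transpose * eta * (L * M) =
      M.transpose * (L.transpose * eta * L) * M by simp only [Matrix.mul_assoc], hL.1, hM.1]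
  · have e : FDCausal (Pi.single 0 1 : Vec4) := ⟨by simp [ip_eq], by simp⟩
    have := time_component_pos hL (e.mulVec hM)
    rw [Matrix.mulVec_mulVec] at this
    simpa using this

theorem SO13_one : (1 : Mat4) ∈ SO13 := ⟨by simp, by simp, by simp⟩

theorem SO13_inv {L : Mat4} (hL : L ∈ SO13) : L⁻¹ ∈ SO13 := by
  refine ⟨?_, by rw [Matrix.det_nonsing_inv, hL.2.1]; simp, ?_⟩
  · rw [lorentz_inv hL.1]
    simp only [Matrix.transpose_mul, Matrix.transpose_transpose, eta_transpose]
    rw [show eta * (L * eta) * eta * (eta * L.transpose * eta) =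
      eta * (L * eta * (eta * eta) * L.transpose) * eta by simp only [Matrix.mul_assoc],
      eta_mul_eta, Matrix.mul_one, lorentz_transpose hL.1, eta_mul_eta, Matrix.one_mul]
  · rw [lorentz_inv hL.1]
    have := hL.2.2
    simpa [eta, Matrix.mul_apply, Fin.sum_univ_four, Matrix.diagonal_apply]

/-! ### The inhomogeneous group and its adjoint orbits. -/

theorem groupMat_mul (L M : Mat4) (b c : Vec4) :
    groupMat L b * groupMat M c = groupMat (L * M) (b + L.mulVec c) := by
  unfold groupMat
  rw [Matrix.fromBlocks_multiply]
  congr 1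
  · simp
  · ext i j
    simp [Matrix.mul_apply, Matrix.mulVec, dotProduct, add_comm]
  · simp
  · simp

theorem groupMat_one_zero : groupMat 1 0 = 1 := by
  unfold groupMat
  rw [← Matrix.fromBlocks_one]
  congr 1
  ext i j; simp

theorem groupMat_mul_inv {L : Mat4} (hL : L ∈ SO13) (b : Vec4) :
    groupMat L b * groupMat L⁻¹ (-(L⁻¹.mulVec b)) = 1 := by
  have hu := lorentz_isUnit_det hL.1
  rw [groupMat_mul, Matrix.mul_nonsing_inv _ hu, Matrix.mulVec_neg, Matrix.mulVec_mulVec,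
    Matrix.mul_nonsing_inv _ hu, Matrix.one_mulVec, add_neg_cancel, groupMat_one_zero]

theorem groupMat_inv {L : Mat4} (hL : L ∈ SO13) (b : Vec4) :
    (groupMat L b)⁻¹ = groupMat L⁻¹ (-(L⁻¹.mulVec b)) :=
  Matrix.inv_eq_right_inv (groupMat_mul_inv hL b)

theorem ISO13_isUnit_det {g : Mat5} (hg : g ∈ ISO13) : IsUnit g.det := by
  obtain ⟨L, hL, b, rfl⟩ := hg
  exact Matrix.isUnit_det_of_right_inverse (groupMat_mul_inv hL b)

theorem ISO13_mul {g h : Mat5} (hg : g ∈ ISO13) (hh : h ∈ ISO13) : g * h ∈ ISO13 := by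
  obtain ⟨L, hL, b, rfl⟩ := hg
  obtain ⟨M, hM, c, rfl⟩ := hh
  exact ⟨L * M, SO13_mul hL hM, _, groupMat_mul L M b c⟩

theorem ISO13_inv {g : Mat5} (hg : g ∈ ISO13) : g⁻¹ ∈ ISO13 := by
  obtain ⟨L, hL, b, rfl⟩ := hg
  exact ⟨L⁻¹, SO13_inv hL, _, groupMat_inv hL b⟩

theorem adOrbit_trans {X Y Z : Mat5} (h : Y ∈ adOrbit X) (h' : Z ∈ adOrbit Y) :
    Z ∈ adOrbit X := by
  obtain ⟨g, hg, rfl⟩ := h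
  obtain ⟨k, hk, rfl⟩ := h'
  exact ⟨k * g, ISO13_mul hk hg, by simp only [Matrix.mul_inv_rev, Matrix.mul_assoc]⟩

theorem adOrbit_symm {X Y : Mat5} (h : Y ∈ adOrbit X) : X ∈ adOrbit Y := by
  obtain ⟨g, hg, rfl⟩ := h
  have hu := ISO13_isUnit_det hg
  refine ⟨g⁻¹, ISO13_inv hg, ?_⟩
  rw [Matrix.nonsing_inv_nonsing_inv _ hu, show g⁻¹ * (g * X * g⁻¹) * g =
    (g⁻¹ * g) * X * (g⁻¹ * g) by simp only [Matrix.mul_assoc], Matrix.nonsing_inv_mul _ hu]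
  simp

theorem groupMat_conj_algMat {L : Mat4} (hL : L ∈ SO13) (b : Vec4) (F : Mat4) (w : Vec4) :
    groupMat L b * algMat F w * (groupMat L b)⁻¹ =
      algMat (L * F * L⁻¹) (L.mulVec (w + F.mulVec (-(L⁻¹.mulVec b)))) := by
  rw [groupMat_inv hL]
  unfold groupMat algMat
  rw [Matrix.fromBlocks_multiply, Matrix.fromBlocks_multiply]
  have e : ∀ (A : Mat4) (v : Vec4), A * Matrix.replicateCol Unit v =
      Matrix.replicateCol Unit (A.mulVec v) := fun A v => by
    ext i j; simp [Matrix.mul_apply, Matrix.mulVec, dotProduct]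
  congr 1
  · simp
  · simp only [Matrix.mul_zero, Matrix.mul_neg, e, add_zero, Matrix.mul_one]
    ext i j
    simp [Matrix.mulVec_add, Matrix.mulVec_neg, Matrix.mulVec_mulVec, Matrix.mul_assoc]
  · simp
  · simp

/-- An inverse-free description of the orbit, used for every later change of frame. Here M is the
inverse of the Lorentz part of the conjugating element. -/
theorem algMat_mem_adOrbit_iff (F F' : Mat4) (w w' : Vec4) :
    algMat F' w' ∈ adOrbit (algMat F w) ↔
      ∃ M ∈ SO13, ∃ c : Vec4, F * M = M * F' ∧ w + F.mulVec c = M.mulVec w' := by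
  constructor
  · rintro ⟨_, ⟨L, hL, b, rfl⟩, h⟩
    rw [groupMat_conj_algMat hL] at h
    have hu := lorentz_isUnit_det hL.1
    unfold algMat at h
    rw [Matrix.fromBlocks_inj] at h
    obtain ⟨h1, h2, -, -⟩ := h
    refine ⟨L⁻¹, SO13_inv hL, -(L⁻¹.mulVec b), ?_, ?_⟩
    · rw [h1, Matrix.mul_assoc, ← Matrix.mul_assoc, Matrix.nonsing_inv_mul _ hu, Matrix.one_mul]
    · have : w' = L.mulVec (w + F.mulVec (-(L⁻¹.mulVec b))) := by
        ext i
        have := congrFun (congrFun h2 i) ()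
        simpa using this
      rw [this, Matrix.mulVec_mulVec, Matrix.nonsing_inv_mul _ hu, Matrix.one_mulVec]
  · rintro ⟨M, hM, c, h1, h2⟩
    have hu := lorentz_isUnit_det hM.1
    refine ⟨groupMat M⁻¹ (-(M⁻¹.mulVec c)), ⟨M⁻¹, SO13_inv hM, _, rfl⟩, ?_⟩
    rw [groupMat_conj_algMat (SO13_inv hM), Matrix.nonsing_inv_nonsing_inv _ hu]
    congr 1
    · rw [Matrix.mul_assoc, h1, ← Matrix.mul_assoc, Matrix.nonsing_inv_mul _ hu, Matrix.one_mul]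
    · have : M.mulVec (-(-(M⁻¹.mulVec c))) = c := by
        rw [neg_neg, Matrix.mulVec_mulVec, Matrix.mul_nonsing_inv _ hu, Matrix.one_mulVec]
      rw [← Matrix.mulVec_neg, this, h2, Matrix.mulVec_mulVec, Matrix.nonsing_inv_mul _ hu,
        Matrix.one_mulVec]

theorem linPart_algMat (F : Mat4) (w : Vec4) : linPart (algMat F w) = F := rfl

theorem transPart_algMat (F : Mat4) (w : Vec4) : transPart (algMat F w) = w := by
  ext i; simp [transPart, algMat]

/-- Conjugation preserves `so(1,3)`. -/
theorem so13_conj {F F' M : Mat4} (hF : F ∈ so13) (hM : M ∈ SO13) (h : F * M = M * F') :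
    F' ∈ so13 := by
  have hu := lorentz_isUnit_det hM.1
  have hF' : F' = M⁻¹ * (F * M) := by
    rw [h, ← Matrix.mul_assoc, Matrix.nonsing_inv_mul _ hu, Matrix.one_mul]
  have e : eta * F' = M.transpose * (eta * F) * M := by
    rw [hF', lorentz_inv hM.1]
    simp only [← Matrix.mul_assoc, eta_mul_eta, Matrix.one_mul]
  unfold so13 at hF ⊢
  rw [mem_ofPred_eq] at hF ⊢
  rw [e, Matrix.transpose_mul (M.transpose * (eta * F)), Matrix.transpose_mul M.transpose,
    Matrix.transpose_transpose, ← Matrix.mul_assoc M.transpose (eta * F).transpose M,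
    ← Matrix.add_mul, ← Matrix.mul_add, hF]
  simp

theorem mem_iso13_of_mem_adOrbit {X Y : Mat5} (hX : X ∈ iso13) (h : Y ∈ adOrbit X) :
    Y ∈ iso13 := by
  obtain ⟨F, hF, w, rfl⟩ := hX
  obtain ⟨g, ⟨L, hL, b, rfl⟩, rfl⟩ := h
  rw [groupMat_conj_algMat hL]
  refine ⟨_, so13_conj hF (SO13_inv hL) (F' := L * F * L⁻¹) ?_, _, rfl⟩
  rw [← Matrix.mul_assoc, ← Matrix.mul_assoc, Matrix.nonsing_inv_mul _ (lorentz_isUnit_det hL.1),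
    Matrix.one_mul]

/-! ### Exponentials and orbits of the flow. -/

open scoped Matrix.Norms.Operator in
/-- The exponential intertwines rectangular matrices. -/
theorem exp_mul_of_mul_eq {m n : Type*} [Fintype m] [DecidableEq m] [Fintype n] [DecidableEq n]
    {A : Matrix m m ℝ} {B : Matrix n n ℝ} {P : Matrix m n ℝ} (h : A * P = P * B) :
    NormedSpace.exp A * P = P * NormedSpace.exp B := by
  have hk : ∀ k : ℕ, A ^ k * P = P * B ^ k := by
    intro k
    induction k with
    | zero => simp
    | succ k ih => rw [pow_succ, Matrix.mul_assoc, h, ← Matrix.mul_assoc, ih, Matrix.mul_assoc,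
        ← pow_succ]
  have hA := (NormedSpace.exp_series_hasSum_exp' (𝕂 := ℝ) A).map
    (Matrix.addMonoidHomMulRight P) (continuous_id.matrix_mul continuous_const)
  have hB := (NormedSpace.exp_series_hasSum_exp' (𝕂 := ℝ) B).map
    (Matrix.addMonoidHomMulLeft P) (continuous_const.matrix_mul continuous_id)
  refine hA.unique ?_
  have e : (P.addMonoidHomMulRight ∘ fun k : ℕ => ((k.factorial : ℝ)⁻¹ • A ^ k)) =
      P.addMonoidHomMulLeft ∘ fun k : ℕ => ((k.factorial : ℝ)⁻¹ • B ^ k) := by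
    funext k
    simp [Matrix.addMonoidHomMulRight, Matrix.addMonoidHomMulLeft, hk]
  rw [e]
  exact hB

/-- The block shape survives exponentiation because the inclusion of the first four coordinates
intertwines with F and the projection to the last one with 0. The translational part needs no
explicit formula. -/
theorem exp_algMat (F : Mat4) (w : Vec4) :
    NormedSpace.exp (algMat F w) =
      groupMat (NormedSpace.exp F) (transPart (NormedSpace.exp (algMat F w))) := by
  have hQ := exp_mul_of_mul_eq (A := algMat F w) (B := F)
    (P := Matrix.fromRows (1 : Mat4) (0 : Matrix Unit (Fin 4) ℝ)) (by
      simp [algMat, Matrix.fromBlocks_mul_fromRows, Matrix.fromRows_mul])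
  have hP := exp_mul_of_mul_eq (A := (0 : Matrix Unit Unit ℝ)) (B := algMat F w)
    (P := Matrix.fromCols (0 : Matrix Unit (Fin 4) ℝ) 1) (by
      simp [algMat, Matrix.fromCols_mul_fromBlocks])
  rw [NormedSpace.exp_zero, Matrix.one_mul] at hP
  ext (i | i) (j | j)
  · have := congrFun (congrFun hQ (Sum.inl i)) j
    simpa [groupMat, Matrix.mul_apply, Matrix.one_apply] using this
  · simp [groupMat, transPart]
  · have := congrFun (congrFun hP i) (Sum.inl j)
    simpa [groupMat, Matrix.mul_apply, Matrix.one_apply] using this.symm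
  · have := congrFun (congrFun hP i) (Sum.inr j)
    simpa [groupMat, Matrix.mul_apply, Matrix.one_apply] using this.symm

theorem exp_mem_SO13 {F : Mat4} (hF : F ∈ so13) : NormedSpace.exp F ∈ SO13 := by
  have key : ∀ G ∈ so13, (NormedSpace.exp G).transpose * eta * NormedSpace.exp G = eta := by
    intro G hG
    have h : G.transpose * eta = eta * (-G) := by
      have h' : eta * G + (eta * G).transpose = 0 := hG
      rw [Matrix.transpose_mul, eta_transpose] at h'
      rw [Matrix.mul_neg]
      exact eq_neg_of_add_eq_zero_right h'
    have := exp_mul_of_mul_eq h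
    rw [Matrix.exp_transpose] at this
    rw [this, Matrix.exp_neg, Matrix.mul_assoc, Matrix.nonsing_inv_mul, Matrix.mul_one]
    exact (Matrix.isUnit_iff_isUnit_det _).mp (Matrix.isUnit_exp G)
  -- The exponential is the square of M = exp(F/2). Hence its determinant is (det M)² = 1, and its
  -- time-time entry is at least 1, since row 0 and column 0 of M have spatial parts of equal
  -- length.
  have hhalf : (1 / 2 : ℝ) • F ∈ so13 := by
    have h' : eta * F + (eta * F).transpose = 0 := hF
    change eta * ((1 / 2 : ℝ) • F) + (eta * ((1 / 2 : ℝ) • F)).transpose = 0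
    rw [Matrix.mul_smul, Matrix.transpose_smul, ← smul_add, h', smul_zero]
  set M := NormedSpace.exp ((1 / 2 : ℝ) • F) with hM
  have hsq : NormedSpace.exp F = M * M := by
    rw [hM, ← Matrix.exp_add_of_commute _ _ (Commute.refl _), ← add_smul]
    norm_num
  have hL := key _ hhalf
  rw [← hM] at hL
  refine ⟨key F hF, ?_, ?_⟩
  · have hd := congrArg Matrix.det hL
    rw [Matrix.det_mul, Matrix.det_mul, Matrix.det_transpose] at hd
    have he : eta.det ≠ 0 := by simp [eta, Matrix.det_diagonal, Fin.prod_univ_four]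
    rw [hsq, Matrix.det_mul]
    apply mul_left_cancel₀ he
    linarith
  · have h1 := lorentz_row_zero hL
    have h2 := lorentz_row_zero (L := M.transpose) (by
      rw [Matrix.transpose_transpose]; exact lorentz_transpose hL)
    simp only [Matrix.transpose_apply] at h2
    have h00 : NormedSpace.exp F 0 0 =
        M 0 0 * M 0 0 + M 0 1 * M 1 0 + M 0 2 * M 2 0 + M 0 3 * M 3 0 := by
      rw [hsq, Matrix.mul_apply, Fin.sum_univ_four]
    rw [h00]
    nlinarith [sq_nonneg (M 0 1 + M 1 0), sq_nonneg (M 0 2 + M 2 0), sq_nonneg (M 0 3 + M 3 0)]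

theorem smul_mem_so13 {F : Mat4} (hF : F ∈ so13) (s : ℝ) : s • F ∈ so13 := by
  have h' : eta * F + (eta * F).transpose = 0 := hF
  change eta * (s • F) + (eta * (s • F)).transpose = 0
  rw [Matrix.mul_smul, Matrix.transpose_smul, ← smul_add, h', smul_zero]

theorem smul_algMat (s : ℝ) (F : Mat4) (w : Vec4) : s • algMat F w = algMat (s • F) (s • w) := by
  unfold algMat
  rw [Matrix.fromBlocks_smul]
  congr 1
  · ext i j; simp
  · simp
  · simp

/-- The space components of the image of a homogeneous vector `(p, t)`. -/
def spacePart : (Fin 4 ⊕ Unit → ℝ) → Vec4 := fun v i => v (Sum.inl i)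

theorem groupMat_mulVec (L : Mat4) (b p : Vec4) (t : ℝ) :
    (groupMat L b).mulVec (Sum.elim p fun _ => t) = Sum.elim (L.mulVec p - t • b) fun _ => t := by
  unfold groupMat
  rw [Matrix.fromBlocks_mulVec]
  ext (i | i)
  · simp [Matrix.mulVec, dotProduct]; ring
  · simp

theorem algMat_mulVec (F : Mat4) (w p : Vec4) (t : ℝ) :
    (algMat F w).mulVec (Sum.elim p fun _ => t) = Sum.elim (F.mulVec p - t • w) fun _ => 0 := by
  unfold algMat
  rw [Matrix.fromBlocks_mulVec]
  ext (i | i)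
  · simp [Matrix.mulVec, dotProduct]; ring
  · simp

open scoped Matrix.Norms.Operator in
theorem hasDerivAt_exp_smul_mulVec (X : Mat5) (v : Fin 4 ⊕ Unit → ℝ) (u : ℝ) :
    HasDerivAt (fun u : ℝ => spacePart ((NormedSpace.exp (u • X)).mulVec v))
      (spacePart ((NormedSpace.exp (u • X)).mulVec (X.mulVec v))) u ∧
    HasDerivAt (fun u : ℝ => spacePart ((NormedSpace.exp (u • X)).mulVec v))
      (spacePart (X.mulVec ((NormedSpace.exp (u • X)).mulVec v))) u := by
  let T : Mat5 →ₗ[ℝ] Vec4 :=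
    { toFun := fun A => spacePart (A.mulVec v)
      map_add' := fun A B => by ext i; simp [spacePart, Matrix.add_mulVec]
      map_smul' := fun r A => by ext i; simp [spacePart, Matrix.smul_mulVec] }
  have h1 := hasDerivAt_exp_smul_const (𝕂 := ℝ) X u
  have h2 := hasDerivAt_exp_smul_const' (𝕂 := ℝ) X u
  constructor
  · have := (LinearMap.toContinuousLinearMap T).hasFDerivAt.comp_hasDerivAt u h1
    rw [Matrix.mulVec_mulVec]
    exact this
  · have := (LinearMap.toContinuousLinearMap T).hasFDerivAt.comp_hasDerivAt u h2
    rw [Matrix.mulVec_mulVec]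
    exact this

/-- The orbit of the point `p`, run backwards. -/
noncomputable def backOrbit (F : Mat4) (w p : Vec4) (u : ℝ) : Vec4 :=
  spacePart ((NormedSpace.exp (u • algMat F w)).mulVec (Sum.elim p fun _ => 1))

theorem backOrbit_zero (F : Mat4) (w p : Vec4) : backOrbit F w p 0 = p := by
  ext i; simp [backOrbit, spacePart]

theorem flow_algMat (F : Mat4) (w p : Vec4) (s : ℝ) :
    flow (algMat F w) s p = backOrbit F w p (-s) := by
  ext i
  simp only [flow, pointMap, backOrbit, spacePart, neg_smul, Matrix.exp_neg]

/-- The first expression is the initial velocity transported by a Lorentz matrix, which keeps it in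
an invariant cone. The second is the field at the current point, which is integrated to find the
displacement. -/
theorem hasDerivAt_backOrbit (F : Mat4) (w p : Vec4) (u : ℝ) :
    HasDerivAt (backOrbit F w p) ((NormedSpace.exp (u • F)).mulVec (F.mulVec p - w)) u ∧
    HasDerivAt (backOrbit F w p) (F.mulVec (backOrbit F w p u) - w) u := by
  obtain ⟨h1, h2⟩ := hasDerivAt_exp_smul_mulVec (algMat F w) (Sum.elim p fun _ => 1) u
  have e1 : ∀ v : Fin 4 ⊕ Unit → ℝ, ∀ i, spacePart v i = v (Sum.inl i) := fun _ _ => rfl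
  constructor
  · suffices h : (NormedSpace.exp (u • F)).mulVec (F.mulVec p - w) = _ by rw [h]; exact h1
    ext i
    rw [algMat_mulVec, smul_algMat, exp_algMat, groupMat_mulVec, e1]
    simp
  · suffices h : F.mulVec (backOrbit F w p u) - w = _ by rw [h]; exact h2
    ext i
    unfold backOrbit
    rw [smul_algMat, exp_algMat, groupMat_mulVec, algMat_mulVec, e1]
    simp only [Sum.elim_inl]
    simp only [one_smul]
    rfl

/-- Displacements along the flow lie in `s (w + Im F)`. -/
theorem exists_displacement (F : Mat4) (w p : Vec4) {s : ℝ} (hs : s ≠ 0) :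
    ∃ c, flow (algMat F w) s p - p = s • (w + F.mulVec c) := by
  have hc : Continuous (backOrbit F w p) :=
    continuous_iff_continuousAt.mpr fun u => (hasDerivAt_backOrbit F w p u).2.continuousAt
  let T : Vec4 →L[ℝ] Vec4 := LinearMap.toContinuousLinearMap (Matrix.mulVecLin F)
  have hT : ∀ v, T v = F.mulVec v := fun v => rfl
  have hi : IntervalIntegrable (backOrbit F w p) MeasureTheory.volume 0 (-s) :=
    hc.intervalIntegrable _ _
  have h := intervalIntegral.integral_eq_sub_of_hasDerivAt
    (f := backOrbit F w p) (f' := fun u => T (backOrbit F w p u) - w) (a := 0) (b := -s)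
    (fun u _ => (hasDerivAt_backOrbit F w p u).2)
    (((T.continuous.comp hc).sub continuous_const).intervalIntegrable _ _)
  rw [intervalIntegral.integral_sub (f := fun u => T (backOrbit F w p u))
    ((T.continuous.comp hc).intervalIntegrable _ _) (continuous_const.intervalIntegrable _ _),
    T.intervalIntegral_comp_comm hi,
    intervalIntegral.integral_const, backOrbit_zero] at h
  -- The witness is minus the mean position of the point between times 0 and s.
  refine ⟨s⁻¹ • ∫ u in (0 : ℝ)..(-s), backOrbit F w p u, ?_⟩
  rw [flow_algMat, ← h, hT, Matrix.mulVec_smul, smul_add, smul_smul, mul_inv_cancel₀ hs, one_smul]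
  simp [add_comm]

/-! ### Causal curves in flat spacetime. -/

/-- A convex cone of vectors, in the form: a curve with velocity in `P` has displacement in `P`. -/
def CurveClosed (P : Vec4 → Prop) : Prop :=
  ∀ γ γ' : ℝ → Vec4, ContinuousOn γ (Icc 0 1) →
    (∀ t ∈ Ioo (0 : ℝ) 1, HasDerivAt γ (γ' t) t) → (∀ t ∈ Ioo (0 : ℝ) 1, P (γ' t)) →
    P (γ 1 - γ 0)

/-- The mean value theorem for a linear functional: linear inequalities pass from velocities to
displacements. -/
theorem exists_ip_displacement {γ γ' : ℝ → Vec4} (hc : ContinuousOn γ (Icc 0 1))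
    (hd : ∀ t ∈ Ioo (0 : ℝ) 1, HasDerivAt γ (γ' t) t) (n : Vec4) :
    ∃ t ∈ Ioo (0 : ℝ) 1, ip n (γ' t) = ip n (γ 1 - γ 0) := by
  let T : Vec4 →ₗ[ℝ] ℝ :=
    { toFun := fun v => ip n v
      map_add' := fun v w => by simp only [ip_eq, Pi.add_apply]; ring
      map_smul' := fun r w => by
        simp only [ip_eq, Pi.smul_apply, smul_eq_mul, RingHom.id_apply]
        ring }
  let T' : Vec4 →L[ℝ] ℝ := LinearMap.toContinuousLinearMap T
  obtain ⟨t, ht, h⟩ := exists_hasDerivAt_eq_slope (fun t => T' (γ t)) (fun t => T' (γ' t))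
    (zero_lt_one) (T'.continuous.comp_continuousOn hc)
    (fun t ht => T'.hasFDerivAt.comp_hasDerivAt t (hd t ht))
  refine ⟨t, ht, ?_⟩
  rw [sub_zero, div_one, ← map_sub] at h
  exact h

theorem ip_neg_of_causal {n v : Vec4} (hn : FDCausal n) (hv : FDTimelike v) : ip n v < 0 := by
  obtain ⟨h1, h2⟩ := hn
  obtain ⟨h3, h4⟩ := hv
  rw [ip_eq] at *
  have key : (n 1 * v 1 + n 2 * v 2 + n 3 * v 3) ^ 2 < (n 0 * v 0) ^ 2 := by
    have c1 : (n 1 * v 1 + n 2 * v 2 + n 3 * v 3) ^ 2 ≤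
        (n 1 ^ 2 + n 2 ^ 2 + n 3 ^ 2) * (v 1 ^ 2 + v 2 ^ 2 + v 3 ^ 2) := by
      nlinarith [sq_nonneg (n 1 * v 2 - n 2 * v 1), sq_nonneg (n 1 * v 3 - n 3 * v 1),
        sq_nonneg (n 2 * v 3 - n 3 * v 2)]
    have c2 : (n 1 ^ 2 + n 2 ^ 2 + n 3 ^ 2) * (v 1 ^ 2 + v 2 ^ 2 + v 3 ^ 2) ≤
        n 0 ^ 2 * (v 1 ^ 2 + v 2 ^ 2 + v 3 ^ 2) :=
      mul_le_mul_of_nonneg_right (by nlinarith) (by positivity)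
    have c3 : n 0 ^ 2 * (v 1 ^ 2 + v 2 ^ 2 + v 3 ^ 2) < n 0 ^ 2 * v 0 ^ 2 :=
      mul_lt_mul_of_pos_left (by nlinarith) (by positivity)
    nlinarith
  have := abs_lt_of_sq_lt_sq' key (by positivity)
  linarith [this.2]

theorem ip_comm (v w : Vec4) : ip v w = ip w v := by simp only [ip_eq]; ring

theorem ip_nonpos_of_causal {n v : Vec4} (hn : FDCausal n) (hv : FDCausal v) : ip n v ≤ 0 := by
  obtain ⟨h1, h2⟩ := hn
  obtain ⟨h3, h4⟩ := hv
  rw [ip_eq] at *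
  have key : (n 1 * v 1 + n 2 * v 2 + n 3 * v 3) ^ 2 ≤ (n 0 * v 0) ^ 2 := by
    have c1 : (n 1 * v 1 + n 2 * v 2 + n 3 * v 3) ^ 2 ≤
        (n 1 ^ 2 + n 2 ^ 2 + n 3 ^ 2) * (v 1 ^ 2 + v 2 ^ 2 + v 3 ^ 2) := by
      nlinarith [sq_nonneg (n 1 * v 2 - n 2 * v 1), sq_nonneg (n 1 * v 3 - n 3 * v 1),
        sq_nonneg (n 2 * v 3 - n 3 * v 2)]
    have c2 : (n 1 ^ 2 + n 2 ^ 2 + n 3 ^ 2) * (v 1 ^ 2 + v 2 ^ 2 + v 3 ^ 2) ≤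
        n 0 ^ 2 * (v 1 ^ 2 + v 2 ^ 2 + v 3 ^ 2) :=
      mul_le_mul_of_nonneg_right (by nlinarith) (by positivity)
    have c3 : n 0 ^ 2 * (v 1 ^ 2 + v 2 ^ 2 + v 3 ^ 2) ≤ n 0 ^ 2 * v 0 ^ 2 :=
      mul_le_mul_of_nonneg_left (by nlinarith) (by positivity)
    nlinarith
  have := abs_le_of_sq_le_sq' key (by positivity)
  linarith [this.2]

theorem fdTimelike_e0 : FDTimelike (Pi.single 0 1 : Vec4) := ⟨by simp [ip_eq], by simp⟩

/-- The null vector with the same space components as `d`. -/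
theorem causal_companion (d : Vec4) (h : 0 < d 1 ^ 2 + d 2 ^ 2 + d 3 ^ 2) :
    FDCausal ![√(d 1 ^ 2 + d 2 ^ 2 + d 3 ^ 2), d 1, d 2, d 3] := by
  refine ⟨?_, by simpa using h⟩
  have := Real.mul_self_sqrt h.le
  rw [ip_eq]
  simp only [Matrix.cons_val]
  linarith

/-- The cone is recognized by duality: a vector with negative product with every future causal n is
future timelike. Testing n = e₀ and the null vector along the spatial part suffices. -/
theorem curveClosed_FDTimelike : CurveClosed FDTimelike := by
  intro γ γ' hc hd hP
  have key : ∀ n, FDCausal n → ip n (γ 1 - γ 0) < 0 := fun n hn => by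
    obtain ⟨t, ht, h⟩ := exists_ip_displacement hc hd n
    rw [← h]
    exact ip_neg_of_causal hn (hP t ht)
  generalize γ 1 - γ 0 = d at key
  have h0 : 0 < d 0 := by
    have := key _ fdTimelike_e0.causal
    simpa [ip_eq] using this
  refine ⟨?_, h0⟩
  rcases (by positivity : 0 ≤ d 1 ^ 2 + d 2 ^ 2 + d 3 ^ 2).eq_or_lt' with h | h
  · rw [ip_eq]; nlinarith
  · have := key _ (causal_companion d h)
    have hs := Real.mul_self_sqrt h.le
    have hp := Real.sqrt_pos.mpr h
    rw [ip_eq] at this ⊢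
    simp only [Matrix.cons_val] at this
    set r := √(d 1 ^ 2 + d 2 ^ 2 + d 3 ^ 2)
    have : r < d 0 := by
      by_contra hcon
      nlinarith
    nlinarith

theorem curveClosed_FDCausal : CurveClosed FDCausal := by
  intro γ γ' hc hd hP
  have key : ∀ n, FDCausal n → ip n (γ 1 - γ 0) ≤ 0 := fun n hn => by
    obtain ⟨t, ht, h⟩ := exists_ip_displacement hc hd n
    rw [← h]
    exact ip_nonpos_of_causal hn (hP t ht)
  -- The closed duality alone would allow displacement zero; the timelike test vector e₀ gives the
  -- strict inequality.
  have key0 : ip (Pi.single 0 1) (γ 1 - γ 0) < 0 := by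
    obtain ⟨t, ht, h⟩ := exists_ip_displacement hc hd (Pi.single 0 1)
    rw [← h, ip_comm]
    exact ip_neg_of_causal (hP t ht) fdTimelike_e0
  generalize γ 1 - γ 0 = d at key key0
  have h0 : 0 < d 0 := by
    simpa [ip_eq] using key0
  refine ⟨?_, h0⟩
  rcases (by positivity : 0 ≤ d 1 ^ 2 + d 2 ^ 2 + d 3 ^ 2).eq_or_lt' with h | h
  · rw [ip_eq]; nlinarith
  · have := key _ (causal_companion d h)
    have hs := Real.mul_self_sqrt h.le
    have hp := Real.sqrt_pos.mpr h
    rw [ip_eq] at this ⊢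
    simp only [Matrix.cons_val] at this
    set r := √(d 1 ^ 2 + d 2 ^ 2 + d 3 ^ 2)
    have : r ≤ d 0 := by
      by_contra hcon
      nlinarith
    nlinarith

end MinkowskiSpace

namespace MinkowskiSpace
-- The dual tensor and the invariants.
-- The right side is the Vandermonde product of the indices, antisymmetric and equal to 12 at (0, 1,
-- 2, 3).
theorem leviCivita_int : ∀ a b c d : Fin 4, 12 *
    Matrix.det (Matrix.of fun i j : Fin 4 => if ![a, b, c, d] i = j then (1 : ℤ) else 0) =
    ((b : ℤ) - a) * (c - a) * (d - a) * (c - b) * (d - b) * (d - c) := by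
  decide +kernel
theorem leviCivita_eq (a b c d : Fin 4) : leviCivita a b c d =
    ((b : ℝ) - a) * (c - a) * (d - a) * (c - b) * (d - b) * (d - c) / 12 := by
  have h := congrArg (Int.cast : ℤ → ℝ) (leviCivita_int a b c d)
  rw [Int.cast_mul, Int.cast_det] at h
  have e : leviCivita a b c d = ((Matrix.of fun i j : Fin 4 =>
      if ![a, b, c, d] i = j then (1 : ℤ) else 0).map (Int.cast : ℤ → ℝ)).det := by
    unfold leviCivita
    congr 1
    ext i j
    simp
  rw [e, eq_div_iff (by norm_num), mul_comm]
  push_cast at h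
  exact h

/-- The dual of an antisymmetric contravariant tensor. -/
def dualUpper (G : Mat4) : Mat4 :=
  !![0, G 2 3, -G 1 3, G 1 2; -G 2 3, 0, G 0 3, -G 0 2; G 1 3, -G 0 3, 0, G 0 1;
    -G 1 2, G 0 2, -G 0 1, 0]

set_option maxHeartbeats 2000000 in
theorem dual_eq_dualUpper {F : Mat4} (hF : (upper F).transpose = -upper F) :
    dual F = dualUpper (upper F) := by
  have h : ∀ a b, upper F b a = - upper F a b := fun a b => congrFun (congrFun hF a) b
  unfold dual
  generalize upper F = G at *
  have h1 := h 0 1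
  have h2 := h 0 2
  have h3 := h 0 3
  have h4 := h 1 2
  have h5 := h 1 3
  have h6 := h 2 3
  ext c d
  fin_cases c <;> fin_cases d <;>
    simp [dualUpper, Fin.sum_univ_four, leviCivita_eq, h1, h2, h3, h4, h5, h6] <;> ring


/-- `dualUpper` contracted with two vectors. -/
theorem dualUpper_contract (G : Mat4) (p q : Vec4) :
    p ⬝ᵥ (dualUpper G).mulVec q =
      G 2 3 * (p 0 * q 1 - p 1 * q 0) - G 1 3 * (p 0 * q 2 - p 2 * q 0) +
      G 1 2 * (p 0 * q 3 - p 3 * q 0) + G 0 3 * (p 1 * q 2 - p 2 * q 1) -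
      G 0 2 * (p 1 * q 3 - p 3 * q 1) + G 0 1 * (p 2 * q 3 - p 3 * q 2) := by
  simp [dualUpper, dotProduct, Matrix.mulVec, Fin.sum_univ_four]
  ring

/-- Laplace expansion along the first two rows, in the 2 × 2 minors that also occur in `conj_entry`.
-/
theorem det_four (M : Mat4) : M.det =
    (M 0 0 * M 1 1 - M 0 1 * M 1 0) * (M 2 2 * M 3 3 - M 2 3 * M 3 2) -
    (M 0 0 * M 1 2 - M 0 2 * M 1 0) * (M 2 1 * M 3 3 - M 2 3 * M 3 1) +
    (M 0 0 * M 1 3 - M 0 3 * M 1 0) * (M 2 1 * M 3 2 - M 2 2 * M 3 1) +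
    (M 0 1 * M 1 2 - M 0 2 * M 1 1) * (M 2 0 * M 3 3 - M 2 3 * M 3 0) -
    (M 0 1 * M 1 3 - M 0 3 * M 1 1) * (M 2 0 * M 3 2 - M 2 2 * M 3 0) +
    (M 0 2 * M 1 3 - M 0 3 * M 1 2) * (M 2 0 * M 3 1 - M 2 1 * M 3 0) := by
  simp [Matrix.det_succ_row_zero, Fin.sum_univ_succ, Fin.succAbove]
  ring

theorem conj_entry {G M : Mat4} (hG : G.transpose = -G) (i j : Fin 4) :
    (M * G * M.transpose) i j =
      G 0 1 * (M i 0 * M j 1 - M i 1 * M j 0) + G 0 2 * (M i 0 * M j 2 - M i 2 * M j 0) +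
      G 0 3 * (M i 0 * M j 3 - M i 3 * M j 0) + G 1 2 * (M i 1 * M j 2 - M i 2 * M j 1) +
      G 1 3 * (M i 1 * M j 3 - M i 3 * M j 1) + G 2 3 * (M i 2 * M j 3 - M i 3 * M j 2) := by
  have h : ∀ a b, G b a = - G a b := fun a b => congrFun (congrFun hG a) b
  have h7 : ∀ a, G a a = 0 := fun a => by linarith [h a a]
  simp only [Matrix.mul_apply, Fin.sum_univ_four, Matrix.transpose_apply, h 0 1, h 0 2, h 0 3,
    h 1 2, h 1 3, h 2 3, h7]
  ring

/-- The Levi-Civita symbol is a tensor density of weight det M. Entrywise, the coefficients of G are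
Laplace expansions of det M or of determinants with repeated columns. -/
theorem dualUpper_conj {G M : Mat4} (hG : G.transpose = -G) :
    M.transpose * dualUpper (M * G * M.transpose) * M = M.det • dualUpper G := by
  ext c d
  have e : (M.transpose * dualUpper (M * G * M.transpose) * M) c d =
      M.col c ⬝ᵥ (dualUpper (M * G * M.transpose)).mulVec (M.col d) := by
    rw [Matrix.mul_assoc]
    simp only [Matrix.mul_apply, dotProduct, Matrix.mulVec, Matrix.transpose_apply, Matrix.col_apply]
  rw [e, dualUpper_contract, Matrix.smul_apply, smul_eq_mul, det_four]
  simp only [conj_entry hG, Matrix.col_apply]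
  fin_cases c <;> fin_cases d <;> simp [dualUpper] <;> ring
theorem upper_antisymm {F : Mat4} (hF : F ∈ so13) : (upper F).transpose = -upper F := by
  have h' : eta * F + (eta * F).transpose = 0 := hF
  have h := congrArg (fun A => eta * A * eta) (eq_neg_of_add_eq_zero_right h')
  simp only [Matrix.transpose_mul, eta_transpose, Matrix.mul_neg, Matrix.neg_mul,
    ← Matrix.mul_assoc, eta_mul_eta, Matrix.one_mul] at h
  rw [Matrix.mul_assoc, eta_mul_eta, Matrix.mul_one] at h
  simpa [upper, Matrix.transpose_mul, eta_transpose] using h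

theorem upper_conj {F F' M : Mat4} (hM : M ∈ SO13) (h : F * M = M * F') :
    upper F = M * upper F' * M.transpose := by
  unfold upper
  rw [← Matrix.mul_assoc, ← h, Matrix.mul_assoc, Matrix.mul_assoc, ← Matrix.mul_assoc M,
    lorentz_transpose hM.1]

theorem dual_conj {F F' M : Mat4} (hF : F ∈ so13) (hM : M ∈ SO13) (h : F * M = M * F') :
    dual F' = M.transpose * dual F * M := by
  have hF' := so13_conj hF hM h
  rw [dual_eq_dualUpper (upper_antisymm hF), dual_eq_dualUpper (upper_antisymm hF'),
    upper_conj hM h, dualUpper_conj (upper_antisymm hF'), hM.2.1, one_smul]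

theorem sum_mul_eq_trace (A B : Mat4) :
    ∑ a, ∑ b, A a b * B a b = (A.transpose * B).trace := by
  simp only [Matrix.trace, Matrix.diag_apply, Matrix.mul_apply, Matrix.transpose_apply]
  rw [Finset.sum_comm]

theorem lower_conj {F F' M : Mat4} (hM : M ∈ SO13) (h : F * M = M * F') :
    lower F' = M.transpose * lower F * M := by
  unfold lower
  rw [Matrix.mul_assoc, Matrix.mul_assoc, h, ← Matrix.mul_assoc eta, ← Matrix.mul_assoc,
    ← Matrix.mul_assoc, hM.1]

/-- The contraction of a covariant with a contravariant tensor is a trace, and the trace is cyclic.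
-/
theorem sum_mul_conj {A A' B B' M : Mat4} (hA : A' = M.transpose * A * M)
    (hB : B = M * B' * M.transpose) :
    ∑ a, ∑ b, A' a b * B' a b = ∑ a, ∑ b, A a b * B a b := by
  rw [sum_mul_eq_trace, sum_mul_eq_trace, hA, hB]
  simp only [Matrix.transpose_mul, Matrix.transpose_transpose, Matrix.mul_assoc]
  rw [Matrix.trace_mul_comm]
  simp only [Matrix.mul_assoc]

theorem I₁_conj {F F' : Mat4} {w w' : Vec4} (h : algMat F' w' ∈ adOrbit (algMat F w)) :
    I₁ (algMat F' w') = I₁ (algMat F w) := by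
  obtain ⟨M, hM, c, h1, h2⟩ := (algMat_mem_adOrbit_iff _ _ _ _).mp h
  unfold I₁
  rw [linPart_algMat, linPart_algMat, sum_mul_conj (lower_conj hM h1) (upper_conj hM h1)]

theorem I₂_conj {F F' : Mat4} {w w' : Vec4} (hF : F ∈ so13)
    (h : algMat F' w' ∈ adOrbit (algMat F w)) :
    I₂ (algMat F' w') = I₂ (algMat F w) := by
  obtain ⟨M, hM, c, h1, h2⟩ := (algMat_mem_adOrbit_iff _ _ _ _).mp h
  unfold I₂
  rw [linPart_algMat, linPart_algMat, sum_mul_conj (dual_conj hF hM h1) (upper_conj hM h1)]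

/-- The element of `so(1,3)` with electric part `e` and magnetic part `b`. -/
def emMat (e1 e2 e3 b1 b2 b3 : ℝ) : Mat4 :=
  !![0, e1, e2, e3; e1, 0, b3, -b2; e2, -b3, 0, b1; e3, b2, -b1, 0]

theorem emMat_mem (e1 e2 e3 b1 b2 b3 : ℝ) : emMat e1 e2 e3 b1 b2 b3 ∈ so13 := by
  change eta * _ + _ = 0
  ext i j
  fin_cases i <;> fin_cases j <;>
    simp [eta, emMat, Matrix.diagonal_mul]

theorem exists_emMat {F : Mat4} (hF : F ∈ so13) :
    ∃ e1 e2 e3 b1 b2 b3, F = emMat e1 e2 e3 b1 b2 b3 := by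
  have h' : eta * F + (eta * F).transpose = 0 := hF
  have h : ∀ i j, (eta * F + (eta * F).transpose) i j = 0 := fun i j => by rw [h']; rfl
  simp only [eta, Matrix.add_apply, Matrix.transpose_apply, Matrix.diagonal_mul] at h
  have h00 := h 0 0
  have h01 := h 0 1
  have h02 := h 0 2
  have h03 := h 0 3
  have h11 := h 1 1
  have h12 := h 1 2
  have h13 := h 1 3
  have h22 := h 2 2
  have h23 := h 2 3
  have h33 := h 3 3
  simp only [Matrix.cons_val] at h00 h01 h02 h03 h11 h12 h13 h22 h23 h33
  refine ⟨F 0 1, F 0 2, F 0 3, F 2 3, F 3 1, F 1 2, ?_⟩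
  ext i j
  fin_cases i <;> fin_cases j <;> simp [emMat] <;> linarith

theorem dual_emMat (e1 e2 e3 b1 b2 b3 : ℝ) : dual (emMat e1 e2 e3 b1 b2 b3) =
    !![0, b1, b2, b3; -b1, 0, e3, -e2; -b2, -e3, 0, e1; -b3, e2, -e1, 0] := by
  rw [dual_eq_dualUpper (upper_antisymm (emMat_mem _ _ _ _ _ _))]
  ext i j
  fin_cases i <;> fin_cases j <;>
    simp [dualUpper, upper, eta, emMat, Matrix.mul_diagonal]

/-- The element of `iso(1,3)` with components `e`, `b`, `w`. -/
def isoMat (e1 e2 e3 b1 b2 b3 w0 w1 w2 w3 : ℝ) : Mat5 :=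
  algMat (emMat e1 e2 e3 b1 b2 b3) ![w0, w1, w2, w3]

section invariants
variable (e1 e2 e3 b1 b2 b3 w0 w1 w2 w3 : ℝ)

theorem I₁_isoMat : I₁ (isoMat e1 e2 e3 b1 b2 b3 w0 w1 w2 w3) =
    (b1 ^ 2 + b2 ^ 2 + b3 ^ 2 - e1 ^ 2 - e2 ^ 2 - e3 ^ 2) / 2 := by
  simp [I₁, isoMat, linPart_algMat, lower, upper, eta, emMat, Fin.sum_univ_four,
    Matrix.mul_diagonal, Matrix.diagonal_mul]
  ring

theorem I₂_isoMat : I₂ (isoMat e1 e2 e3 b1 b2 b3 w0 w1 w2 w3) =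
    -(e1 * b1 + e2 * b2 + e3 * b3) := by
  simp only [I₂, isoMat, linPart_algMat, dual_emMat]
  simp [upper, eta, emMat, Fin.sum_univ_four, Matrix.mul_diagonal]
  ring

theorem I₃_isoMat : I₃ (isoMat e1 e2 e3 b1 b2 b3 w0 w1 w2 w3) =
    -(b1 * w1 + b2 * w2 + b3 * w3) ^ 2 + (-b1 * w0 + e3 * w2 - e2 * w3) ^ 2 +
    (-b2 * w0 - e3 * w1 + e1 * w3) ^ 2 + (-b3 * w0 + e2 * w1 - e1 * w2) ^ 2 := by
  simp only [I₃, isoMat, linPart_algMat, transPart_algMat, dual_emMat, ip_eq]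
  simp [Matrix.mulVec, dotProduct, Fin.sum_univ_four]
  ring

theorem linPart_isoMat_eq_zero : linPart (isoMat e1 e2 e3 b1 b2 b3 w0 w1 w2 w3) = 0 ↔
    e1 = 0 ∧ e2 = 0 ∧ e3 = 0 ∧ b1 = 0 ∧ b2 = 0 ∧ b3 = 0 := by
  constructor
  · intro h
    have h' : ∀ i j, emMat e1 e2 e3 b1 b2 b3 i j = 0 := fun i j => congrFun (congrFun h i) j
    have h1 := h' 0 1
    have h2 := h' 0 2
    have h3 := h' 0 3
    have h4 := h' 2 3
    have h5 := h' 3 1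
    have h6 := h' 1 2
    simp only [emMat, Matrix.of_apply, Matrix.cons_val] at h1 h2 h3 h4 h5 h6
    exact ⟨h1, h2, h3, h4, h5, h6⟩
  · rintro ⟨rfl, rfl, rfl, rfl, rfl, rfl⟩
    ext i j
    fin_cases i <;> fin_cases j <;> simp [isoMat, linPart_algMat, emMat]

theorem isoMat_mem : isoMat e1 e2 e3 b1 b2 b3 w0 w1 w2 w3 ∈ iso13 :=
  ⟨_, emMat_mem _ _ _ _ _ _, _, rfl⟩

end invariants

theorem exists_isoMat {X : Mat5} (hX : X ∈ iso13) : ∃ e1 e2 e3 b1 b2 b3 w0 w1 w2 w3,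
    X = isoMat e1 e2 e3 b1 b2 b3 w0 w1 w2 w3 := by
  obtain ⟨F, hF, w, rfl⟩ := hX
  obtain ⟨e1, e2, e3, b1, b2, b3, rfl⟩ := exists_emMat hF
  refine ⟨e1, e2, e3, b1, b2, b3, w 0, w 1, w 2, w 3, ?_⟩
  unfold isoMat
  congr 1
  ext i; fin_cases i <;> rfl

/-- If `I₂ = 0`, the dual of `F` annihilates the image of `F`. -/
theorem dual_mul_self {F : Mat4} (hF : F ∈ so13) (w : Vec4) (h : I₂ (algMat F w) = 0) :
    dual F * F = 0 := by
  obtain ⟨e1, e2, e3, b1, b2, b3, w0, w1, w2, w3, hX⟩ := exists_isoMat ⟨F, hF, w, rfl⟩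
  have hF' : F = emMat e1 e2 e3 b1 b2 b3 := congrArg linPart hX
  rw [hX, I₂_isoMat] at h
  rw [hF', dual_emMat]
  ext i j
  fin_cases i <;> fin_cases j <;>
    simp [emMat, Matrix.mul_apply, Fin.sum_univ_four] <;> linarith

theorem ip_transpose_mulVec {M : Mat4} (hM : M ∈ SO13) (v : Vec4) :
    ip (M.transpose.mulVec v) (M.transpose.mulVec v) = ip v v :=
  ip_mulVec _ (by rw [Matrix.transpose_transpose]; exact lorentz_transpose hM.1) v v

/-- The shift `F.mulVec c` disappears because the dual of F annihilates Im F; what is left is a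
Lorentz change of the vector F̃w. -/
theorem I₃_conj {F F' : Mat4} {w w' : Vec4} (hF : F ∈ so13)
    (h : algMat F' w' ∈ adOrbit (algMat F w)) (h2 : I₂ (algMat F w) = 0) :
    I₃ (algMat F' w') = I₃ (algMat F w) := by
  obtain ⟨M, hM, c, h1, h3⟩ := (algMat_mem_adOrbit_iff _ _ _ _).mp h
  unfold I₃
  simp only [linPart_algMat, transPart_algMat]
  have : (dual F').mulVec w' = M.transpose.mulVec ((dual F).mulVec w) := by
    rw [dual_conj hF hM h1, ← Matrix.mulVec_mulVec, ← h3, ← Matrix.mulVec_mulVec,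
      Matrix.mulVec_add, Matrix.mulVec_mulVec c, dual_mul_self hF w h2, Matrix.zero_mulVec,
      add_zero]
  rw [this, ip_transpose_mulVec hM]

theorem invariants_eq {X Y : Mat5} (hX : X ∈ iso13) (h : Y ∈ adOrbit X) :
    I₁ Y = I₁ X ∧ I₂ Y = I₂ X ∧ (I₂ X = 0 → I₃ Y = I₃ X) := by
  obtain ⟨F', hF', w', rfl⟩ := mem_iso13_of_mem_adOrbit hX h
  obtain ⟨F, hF, w, rfl⟩ := hX
  exact ⟨I₁_conj h, I₂_conj hF h, I₃_conj hF h⟩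

theorem linPart_eq_zero_of_orbit {X Y : Mat5} (hX : X ∈ iso13) (h : Y ∈ adOrbit X)
    (h0 : linPart X = 0) : linPart Y = 0 := by
  obtain ⟨F, hF, w, rfl⟩ := hX
  obtain ⟨g, ⟨L, hL, b, rfl⟩, rfl⟩ := h
  rw [groupMat_conj_algMat hL, linPart_algMat]
  rw [linPart_algMat] at h0
  simp [h0]

theorem linPart_eq_zero_iff_of_orbit {X Y : Mat5} (hX : X ∈ iso13) (h : Y ∈ adOrbit X) :
    linPart Y = 0 ↔ linPart X = 0 :=
  ⟨linPart_eq_zero_of_orbit (mem_iso13_of_mem_adOrbit hX h) (adOrbit_symm h),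
    linPart_eq_zero_of_orbit hX h⟩

theorem I₄_eq_of_linPart_eq_zero {X : Mat5} (h : linPart X = 0) :
    I₄ X = ip (transPart X) (transPart X) := by
  unfold I₄
  simp [h]

theorem I₄_conj_of_linPart_eq_zero {X Y : Mat5} (hX : X ∈ iso13) (h : Y ∈ adOrbit X)
    (h0 : linPart X = 0) : I₄ Y = I₄ X := by
  rw [I₄_eq_of_linPart_eq_zero h0,
    I₄_eq_of_linPart_eq_zero (linPart_eq_zero_of_orbit hX h h0)]
  obtain ⟨F', hF', w', rfl⟩ := mem_iso13_of_mem_adOrbit hX h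
  obtain ⟨F, hF, w, rfl⟩ := hX
  obtain ⟨M, hM, c, h1, h3⟩ := (algMat_mem_adOrbit_iff _ _ _ _).mp h
  rw [linPart_algMat] at h0
  simp only [transPart_algMat]
  rw [← ip_mulVec M hM.1 w' w', ← h3, h0]
  simp

/-! ### The flow and the translational class -/

/-- The vector field of `X` takes a value in `P` somewhere. -/
def FieldMeets (P : Vec4 → Prop) (X : Mat5) : Prop :=
  ∃ c, P (transPart X + (linPart X).mulVec c)

/-- The straight segment is the extremal case: it has constant velocity y - x. -/
theorem exists_curve_iff {P : Vec4 → Prop} (hP : CurveClosed P) (x y : Vec4) :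
    (∃ γ : ℝ → Vec4, ContDiffOn ℝ 1 γ (Icc 0 1) ∧
      (∀ t ∈ Icc (0 : ℝ) 1, P (derivWithin γ (Icc 0 1) t)) ∧ γ 0 = x ∧ γ 1 = y) ↔
      P (y - x) := by
  constructor
  · rintro ⟨γ, h1, h2, rfl, rfl⟩
    refine hP γ (derivWithin γ (Icc 0 1)) h1.continuousOn (fun t ht => ?_)
      fun t ht => h2 t (Ioo_subset_Icc_self ht)
    have hd := (h1.differentiableOn (by norm_num)) t (Ioo_subset_Icc_self ht)
    exact hd.hasDerivWithinAt.hasDerivAt (Icc_mem_nhds ht.1 ht.2)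
  · intro h
    refine ⟨fun t => x + t • (y - x), by fun_prop, fun t ht => ?_, by simp, by simp⟩
    have hd : HasDerivAt (fun t : ℝ => x + t • (y - x)) (y - x) t := by
      simpa using ((hasDerivAt_id t).smul_const (y - x)).const_add x
    rw [hd.hasDerivWithinAt.derivWithin (uniqueDiffOn_Icc_zero_one t ht)]
    exact h

theorem mem_chronFuture_iff (x y : Vec4) : y ∈ chronFuture x ↔ FDTimelike (y - x) :=
  exists_curve_iff curveClosed_FDTimelike x y

theorem mem_causalFuture_diff_iff (x y : Vec4) :
    y ∈ causalFuture x \ {x} ↔ FDCausal (y - x) := by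
  rw [← exists_curve_iff curveClosed_FDCausal]
  constructor
  · rintro ⟨h | h, h'⟩
    · exact absurd h h'
    · exact h
  · intro h
    refine ⟨Or.inr h, ?_⟩
    rintro rfl
    have := ((exists_curve_iff curveClosed_FDCausal _ _).mp h).2
    simp at this

section flow
variable {P : Vec4 → Prop} (hc : CurveClosed P) (hs : ∀ s > (0 : ℝ), ∀ v, P v → P (s • v))
  (hL : ∀ L ∈ SO13, ∀ v, P v → P (L.mulVec v))

include hc hL in
theorem flow_one_displacement {F : Mat4} (hF : F ∈ so13) {w p : Vec4}
    (h : P (w - F.mulVec p)) : P (flow (algMat F w) 1 p - p) := by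
  have hd : ∀ t : ℝ, HasDerivAt (fun t => backOrbit F w p (-t))
      ((NormedSpace.exp ((-t) • F)).mulVec (w - F.mulVec p)) t := by
    intro t
    have := (hasDerivAt_backOrbit F w p (-t)).1.scomp t (hasDerivAt_neg t)
    rw [neg_one_smul, ← Matrix.mulVec_neg, neg_sub] at this
    exact this
  have := hc (fun t => backOrbit F w p (-t)) _
    (fun t _ => (hd t).continuousAt.continuousWithinAt) (fun t _ => hd t)
    (fun t _ => hL _ (exp_mem_SO13 (smul_mem_so13 hF _)) _ h)
  rw [flow_algMat]
  simpa [backOrbit_zero] using this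

include hc hs hL in
-- Averaging the field along the orbit gives one direction, and following the orbit of -c for unit
-- time gives the other.
theorem flow_meets_iff {X : Mat5} (hX : X ∈ iso13) :
    (∃ q : Vec4, ∃ s : ℝ, 0 < s ∧ P (flow X s q - q)) ↔ FieldMeets P X := by
  obtain ⟨F, hF, w, rfl⟩ := hX
  unfold FieldMeets
  rw [linPart_algMat, transPart_algMat]
  constructor
  · rintro ⟨q, s, hs0, h⟩
    obtain ⟨c, h'⟩ := exists_displacement F w q hs0.ne'
    refine ⟨c, ?_⟩
    rw [h'] at h
    have := hs s⁻¹ (inv_pos.mpr hs0) _ h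
    rwa [smul_smul, inv_mul_cancel₀ hs0.ne', one_smul] at this
  · rintro ⟨c, h⟩
    refine ⟨-c, 1, one_pos, flow_one_displacement hc hL hF ?_⟩
    rwa [Matrix.mulVec_neg, sub_neg_eq_add]

include hL in
theorem FieldMeets.of_orbit {X Y : Mat5} (hX : X ∈ iso13) (h : Y ∈ adOrbit X)
    (hY : FieldMeets P Y) : FieldMeets P X := by
  obtain ⟨F', hF', w', rfl⟩ := mem_iso13_of_mem_adOrbit hX h
  obtain ⟨F, hF, w, rfl⟩ := hX
  obtain ⟨M, hM, c, h1, h2⟩ := (algMat_mem_adOrbit_iff _ _ _ _).mp h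
  obtain ⟨c', hc'⟩ := hY
  refine ⟨c + M.mulVec c', ?_⟩
  have := hL M hM _ hc'
  simp only [linPart_algMat, transPart_algMat] at this ⊢
  rwa [Matrix.mulVec_add, ← h2, Matrix.mulVec_mulVec, ← h1, ← Matrix.mulVec_mulVec, add_assoc,
    ← Matrix.mulVec_add] at this

include hL in
-- The origin is moved to Λ⁻¹b, and P is invariant under Λ.
theorem flow_one_zero_iff {X : Mat5} (hX : X ∈ iso13) :
    P (flow X 1 0 - 0) ↔ P (transPart (NormedSpace.exp X)) := by
  obtain ⟨F, hF, w, rfl⟩ := hX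
  have hE := exp_mem_SO13 hF
  set b := transPart (NormedSpace.exp (algMat F w)) with hb
  have h : flow (algMat F w) 1 0 = (NormedSpace.exp F)⁻¹.mulVec b := by
    ext i
    simp only [flow, pointMap]
    rw [one_smul, exp_algMat, groupMat_inv hE, groupMat_mulVec]
    simp [hb]
  rw [h, sub_zero]
  refine ⟨fun h => ?_, fun h => hL _ (SO13_inv hE) _ h⟩
  have := hL _ hE _ h
  rwa [Matrix.mulVec_mulVec, Matrix.mul_nonsing_inv _ (lorentz_isUnit_det hE.1),
    Matrix.one_mulVec] at this

include hc hs hL in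
theorem fieldMeets_iff_orbit {X : Mat5} (hX : X ∈ iso13) :
    FieldMeets P X ↔ ∃ Y ∈ adOrbit X, P (transPart (NormedSpace.exp Y)) := by
  constructor
  · intro h
    obtain ⟨F, hF, w, rfl⟩ := hX
    obtain ⟨c, hcc⟩ := h
    rw [linPart_algMat, transPart_algMat] at hcc
    have hY : algMat F (w + F.mulVec c) ∈ adOrbit (algMat F w) :=
      (algMat_mem_adOrbit_iff _ _ _ _).mpr ⟨1, SO13_one, c, by simp, by simp⟩
    refine ⟨_, hY, ?_⟩
    rw [← flow_one_zero_iff hL ⟨F, hF, _, rfl⟩]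
    apply flow_one_displacement hc hL hF
    simpa using hcc
  · rintro ⟨Y, hY, h⟩
    have hYi := mem_iso13_of_mem_adOrbit hX hY
    rw [← flow_one_zero_iff hL hYi] at h
    exact FieldMeets.of_orbit hL hX hY ((flow_meets_iff hc hs hL hYi).mp ⟨0, 1, one_pos, h⟩)

end flow

theorem movesToTimelikeFuture_iff {X : Mat5} (hX : X ∈ iso13) :
    MovesToTimelikeFuture X ↔ FieldMeets FDTimelike X := by
  rw [← flow_meets_iff curveClosed_FDTimelike (fun s hs v => FDTimelike.smul hs)
    (fun L hL v => FDTimelike.mulVec hL) hX]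
  simp only [MovesToTimelikeFuture, mem_chronFuture_iff]

theorem movesToCausalFuture_iff {X : Mat5} (hX : X ∈ iso13) :
    MovesToCausalFuture X ↔ FieldMeets FDCausal X := by
  rw [← flow_meets_iff curveClosed_FDCausal (fun s hs v => FDCausal.smul hs)
    (fun L hL v => FDCausal.mulVec hL) hX]
  simp only [MovesToCausalFuture, mem_causalFuture_diff_iff]

theorem exp_mem_iff {X : Mat5} (hX : X ∈ iso13) (P : Vec4 → Prop) :
    (∃ L ∈ SO13, ∃ b : Vec4, P b ∧ NormedSpace.exp X = groupMat L b) ↔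
      P (transPart (NormedSpace.exp X)) := by
  have ht : ∀ L b, transPart (groupMat L b) = b := fun L b => by
    ext i; simp [transPart, groupMat]
  constructor
  · rintro ⟨L, hL, b, hb, h⟩
    rwa [h, ht]
  · intro h
    obtain ⟨F, hF, w, rfl⟩ := hX
    exact ⟨_, exp_mem_SO13 hF, _, h, exp_algMat F w⟩

theorem movesToTimelikeFuture_iff_lnI {X : Mat5} (hX : X ∈ iso13) :
    MovesToTimelikeFuture X ↔ ∃ Y ∈ adOrbit X, Y ∈ lnI := by
  rw [movesToTimelikeFuture_iff hX, fieldMeets_iff_orbit curveClosed_FDTimelike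
    (fun s hs v => FDTimelike.smul hs) (fun L hL v => FDTimelike.mulVec hL) hX]
  refine exists_congr fun Y => and_congr_right fun hY => ?_
  have hYi := mem_iso13_of_mem_adOrbit hX hY
  rw [← exp_mem_iff hYi FDTimelike]
  exact ⟨fun h => ⟨hYi, h⟩, fun h => h.2⟩

theorem movesToCausalFuture_iff_lnJ {X : Mat5} (hX : X ∈ iso13) :
    MovesToCausalFuture X ↔
      ∃ Y ∈ adOrbit X, Y ∈ lnJ ∧ transPart (NormedSpace.exp Y) ≠ 0 := by
  rw [movesToCausalFuture_iff hX, fieldMeets_iff_orbit curveClosed_FDCausal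
    (fun s hs v => FDCausal.smul hs) (fun L hL v => FDCausal.mulVec hL) hX]
  refine exists_congr fun Y => and_congr_right fun hY => ?_
  have hYi := mem_iso13_of_mem_adOrbit hX hY
  have hJ := exp_mem_iff hYi FDNonspacelike
  constructor
  · intro h
    refine ⟨⟨hYi, hJ.mpr (Or.inl h)⟩, fun h0 => ?_⟩
    rw [h0] at h
    simpa using h.2
  · rintro ⟨⟨-, h⟩, h0⟩
    exact (hJ.mp h).resolve_right h0

/-! ### Elementary changes of frame -/

section moves
variable (e1 e2 e3 b1 b2 b3 w0 w1 w2 w3 : ℝ)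

theorem isoMat_mem_adOrbit_of_lorentz {e1 e2 e3 b1 b2 b3 e1' e2' e3' b1' b2' b3' : ℝ}
    {w w' : Vec4} {M : Mat4} (hM : M ∈ SO13)
    (h : emMat e1 e2 e3 b1 b2 b3 * M = M * emMat e1' e2' e3' b1' b2' b3') (hw : w = M.mulVec w') :
    algMat (emMat e1' e2' e3' b1' b2' b3') w' ∈ adOrbit (algMat (emMat e1 e2 e3 b1 b2 b3) w) :=
  (algMat_mem_adOrbit_iff _ _ _ _).mpr ⟨M, hM, 0, h, by simpa using hw⟩

theorem isoMat_rotate12 {c s : ℝ} (h : c ^ 2 + s ^ 2 = 1) :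
    isoMat (c * e1 + s * e2) (-s * e1 + c * e2) e3 (c * b1 + s * b2) (-s * b1 + c * b2) b3
      w0 (c * w1 + s * w2) (-s * w1 + c * w2) w3 ∈
    adOrbit (isoMat e1 e2 e3 b1 b2 b3 w0 w1 w2 w3) := by
  refine isoMat_mem_adOrbit_of_lorentz (M := !![1, 0, 0, 0; 0, c, -s, 0; 0, s, c, 0; 0, 0, 0, 1])
    ⟨?_, ?_, by simp⟩ ?_ ?_
  · ext i j
    fin_cases i <;> fin_cases j <;>
      simp [eta, Matrix.mul_apply, Fin.sum_univ_four, Matrix.diagonal_apply] <;> linarith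
  · rw [det_four]; simp; linarith
  · ext i j
    fin_cases i <;> fin_cases j <;> simp [emMat, Matrix.mul_apply, Fin.sum_univ_four] <;> grind
  · ext i
    fin_cases i <;> simp [Matrix.mulVec, dotProduct, Fin.sum_univ_four] <;> grind

theorem isoMat_rotate23 {c s : ℝ} (h : c ^ 2 + s ^ 2 = 1) :
    isoMat e1 (c * e2 + s * e3) (-s * e2 + c * e3) b1 (c * b2 + s * b3) (-s * b2 + c * b3)
      w0 w1 (c * w2 + s * w3) (-s * w2 + c * w3) ∈
    adOrbit (isoMat e1 e2 e3 b1 b2 b3 w0 w1 w2 w3) := by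
  refine isoMat_mem_adOrbit_of_lorentz (M := !![1, 0, 0, 0; 0, 1, 0, 0; 0, 0, c, -s; 0, 0, s, c])
    ⟨?_, ?_, by simp⟩ ?_ ?_
  · ext i j
    fin_cases i <;> fin_cases j <;>
      simp [eta, Matrix.mul_apply, Fin.sum_univ_four, Matrix.diagonal_apply] <;> linarith
  · rw [det_four]; simp; linarith
  · ext i j
    fin_cases i <;> fin_cases j <;> simp [emMat, Matrix.mul_apply, Fin.sum_univ_four] <;> grind
  · ext i
    fin_cases i <;> simp [Matrix.mulVec, dotProduct, Fin.sum_univ_four] <;> grind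

theorem isoMat_rotate13 {c s : ℝ} (h : c ^ 2 + s ^ 2 = 1) :
    isoMat (c * e1 + s * e3) e2 (-s * e1 + c * e3) (c * b1 + s * b3) b2 (-s * b1 + c * b3)
      w0 (c * w1 + s * w3) w2 (-s * w1 + c * w3) ∈
    adOrbit (isoMat e1 e2 e3 b1 b2 b3 w0 w1 w2 w3) := by
  refine isoMat_mem_adOrbit_of_lorentz (M := !![1, 0, 0, 0; 0, c, 0, -s; 0, 0, 1, 0; 0, s, 0, c])
    ⟨?_, ?_, by simp⟩ ?_ ?_
  · ext i j
    fin_cases i <;> fin_cases j <;>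
      simp [eta, Matrix.mul_apply, Fin.sum_univ_four, Matrix.diagonal_apply] <;> linarith
  · rw [det_four]; simp; linarith
  · ext i j
    fin_cases i <;> fin_cases j <;> simp [emMat, Matrix.mul_apply, Fin.sum_univ_four] <;> grind
  · ext i
    fin_cases i <;> simp [Matrix.mulVec, dotProduct, Fin.sum_univ_four] <;> grind

/-- As for an electromagnetic field, the components along the boost are fixed and the transverse
ones mix in the pairs (e₂, b₃) and (e₃, b₂). -/
theorem isoMat_boost01 {C S : ℝ} (h : C ^ 2 - S ^ 2 = 1) (hC : 0 < C) :
    isoMat e1 (C * e2 - S * b3) (C * e3 + S * b2) b1 (C * b2 + S * e3) (C * b3 - S * e2)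
      (C * w0 - S * w1) (C * w1 - S * w0) w2 w3 ∈
    adOrbit (isoMat e1 e2 e3 b1 b2 b3 w0 w1 w2 w3) := by
  refine isoMat_mem_adOrbit_of_lorentz (M := !![C, S, 0, 0; S, C, 0, 0; 0, 0, 1, 0; 0, 0, 0, 1])
    ⟨?_, ?_, by simpa using hC⟩ ?_ ?_
  · ext i j
    fin_cases i <;> fin_cases j <;>
      simp [eta, Matrix.mul_apply, Fin.sum_univ_four, Matrix.diagonal_apply] <;> linarith
  · rw [det_four]; simp; linarith
  · ext i j
    fin_cases i <;> fin_cases j <;> simp [emMat, Matrix.mul_apply, Fin.sum_univ_four] <;> grind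
  · ext i
    fin_cases i <;> simp [Matrix.mulVec, dotProduct, Fin.sum_univ_four] <;> grind

theorem add_emMat_mulVec (c0 c1 c2 c3 : ℝ) :
    ![w0, w1, w2, w3] + (emMat e1 e2 e3 b1 b2 b3).mulVec ![c0, c1, c2, c3] =
      ![w0 + (e1 * c1 + e2 * c2 + e3 * c3), w1 + (e1 * c0 + b3 * c2 - b2 * c3),
        w2 + (e2 * c0 - b3 * c1 + b1 * c3), w3 + (e3 * c0 + b2 * c1 - b1 * c2)] := by
  ext i
  fin_cases i <;> simp [emMat, Matrix.mulVec, dotProduct, Fin.sum_univ_four] <;> ring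

theorem isoMat_translate (c0 c1 c2 c3 : ℝ) :
    isoMat e1 e2 e3 b1 b2 b3 (w0 + (e1 * c1 + e2 * c2 + e3 * c3))
      (w1 + (e1 * c0 + b3 * c2 - b2 * c3)) (w2 + (e2 * c0 - b3 * c1 + b1 * c3))
      (w3 + (e3 * c0 + b2 * c1 - b1 * c2)) ∈
    adOrbit (isoMat e1 e2 e3 b1 b2 b3 w0 w1 w2 w3) :=
  (algMat_mem_adOrbit_iff _ _ _ _).mpr ⟨1, SO13_one, ![c0, c1, c2, c3], by simp, by
    rw [add_emMat_mulVec]; simp⟩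

theorem fieldMeets_isoMat (P : Vec4 → Prop) :
    FieldMeets P (isoMat e1 e2 e3 b1 b2 b3 w0 w1 w2 w3) ↔ ∃ c0 c1 c2 c3,
      P ![w0 + (e1 * c1 + e2 * c2 + e3 * c3), w1 + (e1 * c0 + b3 * c2 - b2 * c3),
        w2 + (e2 * c0 - b3 * c1 + b1 * c3), w3 + (e3 * c0 + b2 * c1 - b1 * c2)] := by
  simp only [FieldMeets, isoMat, linPart_algMat, transPart_algMat, ← add_emMat_mulVec]
  constructor
  · rintro ⟨c, h⟩
    refine ⟨c 0, c 1, c 2, c 3, ?_⟩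
    rwa [show ![c 0, c 1, c 2, c 3] = c by ext i; fin_cases i <;> rfl]
  · rintro ⟨c0, c1, c2, c3, h⟩
    exact ⟨_, h⟩

end moves

theorem fdTimelike_vec_iff (w0 w1 w2 w3 : ℝ) :
    FDTimelike ![w0, w1, w2, w3] ↔ w1 ^ 2 + w2 ^ 2 + w3 ^ 2 < w0 ^ 2 ∧ 0 < w0 := by
  unfold FDTimelike
  rw [ip_eq]
  simp only [Matrix.cons_val]
  refine and_congr_left fun _ => ?_
  constructor <;> intro h <;> linarith

theorem fdCausal_vec_iff (w0 w1 w2 w3 : ℝ) :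
    FDCausal ![w0, w1, w2, w3] ↔ w1 ^ 2 + w2 ^ 2 + w3 ^ 2 ≤ w0 ^ 2 ∧ 0 < w0 := by
  unfold FDCausal
  rw [ip_eq]
  simp only [Matrix.cons_val]
  refine and_congr_left fun _ => ?_
  constructor <;> intro h <;> linarith

/-! ### Planar rotations and boosts -/

theorem exists_rotation_second (x y : ℝ) :
    ∃ c s : ℝ, c ^ 2 + s ^ 2 = 1 ∧ -s * x + c * y = 0 ∧ 0 ≤ c * x + s * y := by
  by_cases h : x ^ 2 + y ^ 2 = 0
  · have hx : x = 0 := by nlinarith [sq_nonneg x, sq_nonneg y]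
    have hy : y = 0 := by nlinarith [sq_nonneg x, sq_nonneg y]
    exact ⟨1, 0, by norm_num, by simp [hy], by simp [hx]⟩
  · have hp : 0 < x ^ 2 + y ^ 2 := lt_of_le_of_ne (by positivity) (Ne.symm h)
    have hr := Real.sqrt_pos.mpr hp
    have hs := Real.sq_sqrt hp.le
    set r := √(x ^ 2 + y ^ 2)
    refine ⟨x / r, y / r, by field_simp; linarith, by field_simp; ring, ?_⟩
    have : x / r * x + y / r * y = (x ^ 2 + y ^ 2) / r := by ring
    rw [this]
    positivity

theorem exists_rotation_first (x y : ℝ) :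
    ∃ c s : ℝ, c ^ 2 + s ^ 2 = 1 ∧ c * x + s * y = 0 ∧ 0 ≤ -s * x + c * y := by
  obtain ⟨c, s, h1, h2, h3⟩ := exists_rotation_second x y
  exact ⟨s, -c, by linarith, by linarith, by linarith⟩

theorem exists_rotation_second_neg (x y : ℝ) :
    ∃ c s : ℝ, c ^ 2 + s ^ 2 = 1 ∧ -s * x + c * y = 0 ∧ c * x + s * y ≤ 0 := by
  obtain ⟨c, s, h1, h2, h3⟩ := exists_rotation_second x y
  exact ⟨-c, -s, by linarith, by linarith, by linarith⟩

theorem exists_rotation_first_neg (x y : ℝ) :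
    ∃ c s : ℝ, c ^ 2 + s ^ 2 = 1 ∧ c * x + s * y = 0 ∧ -s * x + c * y ≤ 0 := by
  obtain ⟨c, s, h1, h2, h3⟩ := exists_rotation_first x y
  exact ⟨-c, -s, by linarith, by linarith, by linarith⟩

/-- The boost with Doppler factor `k`. -/
theorem exists_boost_scale {k : ℝ} (hk : 0 < k) :
    ∃ C S : ℝ, C ^ 2 - S ^ 2 = 1 ∧ 0 < C ∧ C - S = k ∧ C + S = k⁻¹ :=
  ⟨(k + k⁻¹) / 2, (k⁻¹ - k) / 2, by field_simp; ring, by positivity, by ring, by ring⟩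

/-- The boost diagonalizing the quadratic form `W (x² + y²) / 2 + 2 q x y`. -/
theorem exists_boost_diagonal {W q : ℝ} (hW : 0 < W) (hD : 0 < W ^ 2 - 4 * q ^ 2) :
    ∃ C S : ℝ, C ^ 2 - S ^ 2 = 1 ∧ 0 < C ∧ C * S * W + (C ^ 2 + S ^ 2) * q = 0 := by
  have hr := Real.sqrt_pos.mpr hD
  have hs := Real.sq_sqrt hD.le
  set r := √(W ^ 2 - 4 * q ^ 2)
  -- With C = cosh t and S = sinh t the condition reads tanh 2t = -2q/W. So cosh 2t = W/r and sinh
  -- 2t = -2q/r, and half-angle formulas give C and S.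
  have hp : 0 < (W / r + 1) / 2 := by positivity
  have hC := Real.sqrt_pos.mpr hp
  have hCs := Real.sq_sqrt hp.le
  set C := √((W / r + 1) / 2)
  have hC2 : C ^ 2 * (2 * r) = W + r := by rw [hCs]; field_simp
  have hS2 : (q / (r * C)) ^ 2 * (2 * r) = W - r := by
    have : (W + r) ≠ 0 := by positivity
    have h4 : (q / (r * C)) ^ 2 * (2 * r) = 4 * q ^ 2 / (C ^ 2 * (2 * r)) := by field_simp; ring
    rw [h4, hC2]
    field_simp
    linarith
  refine ⟨C, -(q / (r * C)), ?_, hC, ?_⟩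
  · have : (C ^ 2 - (q / (r * C)) ^ 2 - 1) * (2 * r) = 0 := by linarith
    have := (mul_eq_zero.mp this).resolve_right (by positivity)
    linarith
  · have h5 : C * -(q / (r * C)) = -(q / r) := by field_simp
    have h6 : C ^ 2 + (-(q / (r * C))) ^ 2 = W / r := by
      have : (C ^ 2 + (q / (r * C)) ^ 2) * (2 * r) = 2 * W := by linarith
      field_simp at this ⊢
      linarith
    rw [h5, h6]
    ring

/-- Hyperbolic rotations act transitively on each half-branch of a hyperbola. -/
theorem exists_boost_transitive {A B A' B' : ℝ} (hA : 0 ≤ A) (hB : 0 ≤ B) (hA' : 0 ≤ A')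
    (hB' : 0 ≤ B') (h : A ^ 2 - B ^ 2 = A' ^ 2 - B' ^ 2) (h0 : A = B → 0 < B ∧ 0 < B') :
    ∃ C S : ℝ, C ^ 2 - S ^ 2 = 1 ∧ 0 < C ∧ C * A - S * B = A' ∧ C * B - S * A = B' := by
  by_cases hAB : A = B
  · obtain ⟨h1, h2⟩ := h0 hAB
    have hAB' : A' = B' := by
      rw [hAB] at h
      exact (sq_eq_sq₀ hA' hB').mp (by linarith)
    obtain ⟨C, S, h3, h4, h5, -⟩ := exists_boost_scale (div_pos h2 h1)
    have : (C - S) * B = B' := by rw [h5]; field_simp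
    exact ⟨C, S, h3, h4, by rw [hAB, hAB']; linarith, by rw [hAB]; linarith⟩
  · have hD : B ^ 2 - A ^ 2 ≠ 0 := fun h' => hAB ((sq_eq_sq₀ hA hB).mp (by linarith))
    -- Cramer's rule for the two linear equations in C and S. Positivity of C holds because (A, B)
    -- and (A', B') lie on the same side of the diagonal.
    refine ⟨(B * B' - A * A') / (B ^ 2 - A ^ 2), (B' * A - A' * B) / (B ^ 2 - A ^ 2),
      ?_, ?_, ?_, ?_⟩
    · rw [div_pow, div_pow, ← sub_div, div_eq_one_iff_eq (pow_ne_zero 2 hD)]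
      linear_combination (A ^ 2 - B ^ 2) * (-h)
    · rcases lt_or_gt_of_ne hAB with hl | hl
      · have hl' : A' < B' := lt_of_pow_lt_pow_left₀ 2 hB' (by nlinarith)
        apply div_pos
        · nlinarith
        · nlinarith
      · have hl' : B' < A' := lt_of_pow_lt_pow_left₀ 2 hA' (by nlinarith)
        apply div_pos_of_neg_of_neg
        · nlinarith
        · nlinarith
    · field_simp; ring
    · field_simp; ring

/-! ### Normal forms -/

/-- A rest frame of the timelike translational part. -/
theorem exists_rest_frame (e1 e2 e3 b1 b2 b3 : ℝ) {w0 w1 w2 w3 : ℝ} (h0 : 0 < w0)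
    (h : w1 ^ 2 + w2 ^ 2 + w3 ^ 2 < w0 ^ 2) :
    ∃ e1' e2' e3' b1' b2' b3' τ : ℝ, 0 < τ ∧ isoMat e1' e2' e3' b1' b2' b3' τ 0 0 0 ∈
      adOrbit (isoMat e1 e2 e3 b1 b2 b3 w0 w1 w2 w3) := by
  obtain ⟨c, s, hcs, hk, -⟩ := exists_rotation_second w2 w3
  have m1 := isoMat_rotate23 e1 e2 e3 b1 b2 b3 w0 w1 w2 w3 hcs
  have hn : (c * w2 + s * w3) ^ 2 = w2 ^ 2 + w3 ^ 2 := by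
    linear_combination (w2 ^ 2 + w3 ^ 2) * hcs - (-s * w2 + c * w3) * hk
  rw [hk] at m1
  generalize c * w2 + s * w3 = v at m1 hn
  obtain ⟨c', s', hcs', hk', -⟩ := exists_rotation_second w1 v
  have m2 := adOrbit_trans m1 (isoMat_rotate12 _ _ _ _ _ _ _ _ _ _ hcs')
  have hn' : (c' * w1 + s' * v) ^ 2 = w1 ^ 2 + v ^ 2 := by
    linear_combination (w1 ^ 2 + v ^ 2) * hcs' - (-s' * w1 + c' * v) * hk'
  rw [hk'] at m2
  generalize c' * w1 + s' * v = u at m2 hn'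
  have hp : 0 < w0 ^ 2 - u ^ 2 := by linarith
  have hr := Real.sqrt_pos.mpr hp
  have hs := Real.sq_sqrt hp.le
  set r := √(w0 ^ 2 - u ^ 2)
  have hb : (w0 / r) ^ 2 - (u / r) ^ 2 = 1 := by field_simp; linarith
  have m3 := adOrbit_trans m2 (isoMat_boost01 _ _ _ _ _ _ _ _ _ _ hb (by positivity))
  have ht : w0 / r * w0 - u / r * u = r := by field_simp; linarith
  rw [ht, show w0 / r * u - u / r * w0 = 0 by ring] at m3
  exact ⟨_, _, _, _, _, _, r, hr, m3⟩

/-- Orthogonal electric and magnetic parts can be rotated to the axes. -/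
theorem exists_frame_of_orthogonal {e1 e2 e3 b1 b2 b3 : ℝ} (w0 w1 w2 w3 : ℝ)
    (h : e1 * b1 + e2 * b2 + e3 * b3 = 0) :
    ∃ α β w1' w2' w3' : ℝ, α ≤ 0 ∧ β ≤ 0 ∧
      w1' ^ 2 + w2' ^ 2 + w3' ^ 2 = w1 ^ 2 + w2 ^ 2 + w3 ^ 2 ∧
      isoMat 0 α 0 0 0 β w0 w1' w2' w3' ∈
        adOrbit (isoMat e1 e2 e3 b1 b2 b3 w0 w1 w2 w3) := by
  obtain ⟨c, s, hcs, hk, -⟩ := exists_rotation_first e1 e2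
  have m1 := isoMat_rotate12 e1 e2 e3 b1 b2 b3 w0 w1 w2 w3 hcs
  -- The spatial length of w is tracked through the rotations, so that a rest frame remains one.
  have hw1 : (c * w1 + s * w2) ^ 2 + (-s * w1 + c * w2) ^ 2 = w1 ^ 2 + w2 ^ 2 := by
    linear_combination (w1 ^ 2 + w2 ^ 2) * hcs
  have h1 : (c * e1 + s * e2) * (c * b1 + s * b2) + (-s * e1 + c * e2) * (-s * b1 + c * b2) +
      e3 * b3 = 0 := by
    linear_combination h + (e1 * b1 + e2 * b2) * hcs
  rw [hk] at m1 h1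
  generalize -s * e1 + c * e2 = x2, c * b1 + s * b2 = y1, -s * b1 + c * b2 = y2,
    c * w1 + s * w2 = v1, -s * w1 + c * w2 = v2 at m1 h1 hw1
  obtain ⟨c', s', hcs', hk', hx⟩ := exists_rotation_second_neg x2 e3
  have m2 := adOrbit_trans m1 (isoMat_rotate23 _ _ _ _ _ _ _ _ _ _ hcs')
  have hw2 : (c' * v2 + s' * w3) ^ 2 + (-s' * v2 + c' * w3) ^ 2 = v2 ^ 2 + w3 ^ 2 := by
    linear_combination (v2 ^ 2 + w3 ^ 2) * hcs'
  have h2 : (c' * x2 + s' * e3) * (c' * y2 + s' * b3) +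
      (-s' * x2 + c' * e3) * (-s' * y2 + c' * b3) = 0 := by
    linear_combination h1 + (x2 * y2 + e3 * b3) * hcs'
  rw [hk'] at m2 h2
  generalize c' * x2 + s' * e3 = x, c' * y2 + s' * b3 = z2, -s' * y2 + c' * b3 = z3,
    c' * v2 + s' * w3 = u2, -s' * v2 + c' * w3 = u3 at m2 h2 hw2 hx
  by_cases hx0 : x = 0
  · subst hx0
    obtain ⟨p, q, hpq, hl, -⟩ := exists_rotation_first y1 z2
    have m3 := adOrbit_trans m2 (isoMat_rotate12 _ _ _ _ _ _ _ _ _ _ hpq)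
    have hw3 : (p * v1 + q * u2) ^ 2 + (-q * v1 + p * u2) ^ 2 = v1 ^ 2 + u2 ^ 2 := by
      linear_combination (v1 ^ 2 + u2 ^ 2) * hpq
    rw [hl] at m3
    obtain ⟨p', q', hpq', hl', hz⟩ := exists_rotation_first_neg (-q * y1 + p * z2) z3
    have m4 := adOrbit_trans m3 (isoMat_rotate23 _ _ _ _ _ _ _ _ _ _ hpq')
    rw [hl'] at m4
    simp only [mul_zero, add_zero] at m4
    refine ⟨_, _, _, _, _, le_rfl, hz, ?_, m4⟩
    linear_combination hw1 + hw2 + hw3 + ((-q * v1 + p * u2) ^ 2 + u3 ^ 2) * hpq'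
  -- Orthogonality removes the magnetic component along e, so the last rotation, about the second
  -- axis, leaves e fixed.
  · have hz2 : z2 = 0 := by
      have : x * z2 = 0 := by linarith
      exact (mul_eq_zero.mp this).resolve_left hx0
    subst hz2
    obtain ⟨p, q, hpq, hl, hz⟩ := exists_rotation_first_neg y1 z3
    have m3 := adOrbit_trans m2 (isoMat_rotate13 _ _ _ _ _ _ _ _ _ _ hpq)
    rw [hl] at m3
    simp only [mul_zero, add_zero] at m3
    refine ⟨_, _, _, _, _, hx, hz, ?_, m3⟩
    linear_combination hw1 + hw2 + (v1 ^ 2 + u3 ^ 2) * hpq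

/-- If `I₁` and `I₂` do not both vanish, there is a frame with electric and magnetic part along
the first axis. -/
theorem exists_frame_of_parallel {e1 e2 e3 b1 b2 b3 : ℝ} (w0 w1 w2 w3 : ℝ)
    (h : ¬ (e1 ^ 2 + e2 ^ 2 + e3 ^ 2 = b1 ^ 2 + b2 ^ 2 + b3 ^ 2 ∧
      e1 * b1 + e2 * b2 + e3 * b3 = 0)) :
    ∃ φ θ w0' w1' w2' w3' : ℝ, φ ≤ 0 ∧ (φ = 0 → 0 ≤ θ) ∧
      isoMat φ 0 0 θ 0 0 w0' w1' w2' w3' ∈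
        adOrbit (isoMat e1 e2 e3 b1 b2 b3 w0 w1 w2 w3) := by
  obtain ⟨c, s, hcs, hk, -⟩ := exists_rotation_first e1 e2
  have m1 := isoMat_rotate12 e1 e2 e3 b1 b2 b3 w0 w1 w2 w3 hcs
  rw [hk] at m1
  obtain ⟨c', s', hcs', hk', -⟩ := exists_rotation_first (-s * e1 + c * e2) e3
  have m2 := adOrbit_trans m1 (isoMat_rotate23 _ _ _ _ _ _ _ _ _ _ hcs')
  rw [hk'] at m2
  generalize -s' * (-s * e1 + c * e2) + c' * e3 = x at m2
  generalize c * b1 + s * b2 = y1, c' * (-s * b1 + c * b2) + s' * b3 = y2,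
    -s' * (-s * b1 + c * b2) + c' * b3 = y3 at m2
  obtain ⟨p, q, hpq, hl, -⟩ := exists_rotation_first y1 y2
  have m3 := adOrbit_trans m2 (isoMat_rotate12 _ _ _ _ _ _ _ _ _ _ hpq)
  rw [hl] at m3
  simp only [mul_zero, add_zero] at m3
  generalize -q * y1 + p * y2 = z at m3
  have hinv := invariants_eq (isoMat_mem _ _ _ _ _ _ _ _ _ _) m3
  rw [I₁_isoMat, I₁_isoMat, I₂_isoMat, I₂_isoMat] at hinv
  obtain ⟨i1, i2, -⟩ := hinv
  -- Now e = (0, 0, x) and b = (0, z, y3). The discriminant equals 4(I₁² + I₂²), which is where the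
  -- hypothesis enters.
  have hD : 0 < (x ^ 2 + z ^ 2 + y3 ^ 2) ^ 2 - 4 * (x * z) ^ 2 := by
    have e : (x ^ 2 + z ^ 2 + y3 ^ 2) ^ 2 - 4 * (x * z) ^ 2 =
      (z ^ 2 + y3 ^ 2 - x ^ 2) ^ 2 + 4 * (x * y3) ^ 2 := by ring
    rw [e]
    by_contra hcon
    apply h
    have n1 := sq_nonneg (z ^ 2 + y3 ^ 2 - x ^ 2)
    have n2 := sq_nonneg (x * y3)
    have z1 : z ^ 2 + y3 ^ 2 - x ^ 2 = 0 := by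
      apply pow_eq_zero_iff (two_ne_zero) |>.mp; linarith
    have z2 : x * y3 = 0 := by
      apply pow_eq_zero_iff (two_ne_zero) |>.mp; linarith
    constructor <;> linarith
  have hW : 0 < x ^ 2 + z ^ 2 + y3 ^ 2 := by
    have : 0 ≤ x ^ 2 + z ^ 2 + y3 ^ 2 := by positivity
    rcases this.eq_or_lt' with h0 | h0
    · rw [h0] at hD
      nlinarith [sq_nonneg (x * z)]
    · exact h0
  -- The boost is taken along e × b, with the rapidity that makes e × b vanish.
  obtain ⟨C, S, hCS, hC, hdiag⟩ := exists_boost_diagonal hW hD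
  have m4 := adOrbit_trans m3 (isoMat_boost01 _ _ _ _ _ _ _ _ _ _ hCS hC)
  have hpar : (C * 0 - S * y3) * (C * y3 - S * 0) - (C * x + S * z) * (C * z + S * x) = 0 := by
    linear_combination -hdiag
  generalize C * 0 - S * y3 = f2, C * y3 - S * 0 = g3, C * x + S * z = f3,
    C * z + S * x = g2 at m4 hpar
  by_cases hf : f2 = 0 ∧ f3 = 0
  · obtain ⟨rfl, rfl⟩ := hf
    obtain ⟨k, l, hkl, hr, -⟩ := exists_rotation_second g2 g3
    have m5 := adOrbit_trans m4 (isoMat_rotate23 _ _ _ _ _ _ _ _ _ _ hkl)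
    rw [hr] at m5
    obtain ⟨k', l', hkl', hr', hθ⟩ := exists_rotation_second 0 (k * g2 + l * g3)
    have m6 := adOrbit_trans m5 (isoMat_rotate12 _ _ _ _ _ _ _ _ _ _ hkl')
    rw [hr'] at m6
    simp only [mul_zero, zero_add, add_zero] at m6 hθ
    exact ⟨_, _, _, _, _, _, le_rfl, fun _ => hθ, m6⟩
  · obtain ⟨k, l, hkl, hr, -⟩ := exists_rotation_second f2 f3
    have m5 := adOrbit_trans m4 (isoMat_rotate23 _ _ _ _ _ _ _ _ _ _ hkl)
    have hpar' : (k * f2 + l * f3) * (-l * g2 + k * g3) -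
        (-l * f2 + k * f3) * (k * g2 + l * g3) = 0 := by
      linear_combination hpar + (f2 * g3 - f3 * g2) * hkl
    have hne : k * f2 + l * f3 ≠ 0 := by
      intro h0
      apply hf
      constructor
      · linear_combination (-f2) * hkl + k * h0 - l * hr
      · linear_combination (-f3) * hkl + l * h0 + k * hr
    rw [hr] at m5 hpar'
    have hg : -l * g2 + k * g3 = 0 := by
      rw [zero_mul, sub_zero] at hpar'
      exact (mul_eq_zero.mp hpar').resolve_left hne
    rw [hg] at m5
    generalize k * f2 + l * f3 = f, k * g2 + l * g3 = g at m5 hne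
    obtain ⟨k', l', hkl', hr', hφ⟩ := exists_rotation_second_neg 0 f
    have m6 := adOrbit_trans m5 (isoMat_rotate12 _ _ _ _ _ _ _ _ _ _ hkl')
    have hk0 : k' = 0 := by
      rw [mul_zero, zero_add] at hr'
      exact (mul_eq_zero.mp hr').resolve_right hne
    subst hk0
    simp only [mul_zero, zero_add, add_zero, zero_mul] at m6 hφ
    refine ⟨_, _, _, _, _, _, hφ, fun this => ?_, m6⟩
    exfalso
    rcases mul_eq_zero.mp this with h1 | h1
    · rw [h1] at hkl'; norm_num at hkl'
    · exact hne h1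

/-! ### The forms in components -/

theorem algMat_add (F F' : Mat4) (w w' : Vec4) :
    algMat F w + algMat F' w' = algMat (F + F') (w + w') := by
  unfold algMat
  rw [Matrix.fromBlocks_add]
  congr 1
  · ext i j
    simp only [Matrix.add_apply, Matrix.neg_apply, Matrix.replicateCol_apply, Pi.add_apply]
    ring
  · simp
  · simp

theorem isoMat_add (e1 e2 e3 b1 b2 b3 w0 w1 w2 w3 e1' e2' e3' b1' b2' b3' w0' w1' w2' w3' : ℝ) :
    isoMat e1 e2 e3 b1 b2 b3 w0 w1 w2 w3 + isoMat e1' e2' e3' b1' b2' b3' w0' w1' w2' w3' =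
      isoMat (e1 + e1') (e2 + e2') (e3 + e3') (b1 + b1') (b2 + b2') (b3 + b3')
        (w0 + w0') (w1 + w1') (w2 + w2') (w3 + w3') := by
  unfold isoMat
  rw [algMat_add]
  congr 1
  · ext i j
    rw [Matrix.add_apply]
    fin_cases i <;> fin_cases j <;> simp [emMat, add_comm]
  · ext i
    rw [Pi.add_apply]
    fin_cases i <;> simp

theorem smul_isoMat (r e1 e2 e3 b1 b2 b3 w0 w1 w2 w3 : ℝ) :
    r • isoMat e1 e2 e3 b1 b2 b3 w0 w1 w2 w3 = isoMat (r * e1) (r * e2) (r * e3) (r * b1) (r * b2)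
      (r * b3) (r * w0) (r * w1) (r * w2) (r * w3) := by
  unfold isoMat
  rw [smul_algMat]
  congr 1
  · ext i j
    rw [Matrix.smul_apply]
    fin_cases i <;> fin_cases j <;> simp [emMat]
  · ext i
    rw [Pi.smul_apply]
    fin_cases i <;> simp

theorem genJ_eq {a b : Fin 4} {e1 e2 e3 b1 b2 b3 : ℝ} (h : genM a b = emMat e1 e2 e3 b1 b2 b3) :
    genJ a b = isoMat e1 e2 e3 b1 b2 b3 0 0 0 0 := by
  unfold genJ isoMat algMat
  rw [h]
  congr 1
  ext i j
  rw [Matrix.neg_apply, Matrix.replicateCol_apply, Matrix.zero_apply]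
  fin_cases i <;> simp

theorem K1_eq : K1 = isoMat (-1) 0 0 0 0 0 0 0 0 0 := by
  refine genJ_eq ?_
  ext i j
  simp only [genM, Matrix.of_apply, eta, Matrix.diagonal_apply]
  fin_cases i <;> fin_cases j <;> simp [emMat]

theorem K2_eq : K2 = isoMat 0 (-1) 0 0 0 0 0 0 0 0 := by
  refine genJ_eq ?_
  ext i j
  simp only [genM, Matrix.of_apply, eta, Matrix.diagonal_apply]
  fin_cases i <;> fin_cases j <;> simp [emMat]

theorem J1_eq : J1 = isoMat 0 0 0 1 0 0 0 0 0 0 := by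
  refine genJ_eq ?_
  ext i j
  simp only [genM, Matrix.of_apply, eta, Matrix.diagonal_apply]
  fin_cases i <;> fin_cases j <;> simp [emMat]

theorem J3_eq : J3 = isoMat 0 0 0 0 0 1 0 0 0 0 := by
  refine genJ_eq ?_
  ext i j
  simp only [genM, Matrix.of_apply, eta, Matrix.diagonal_apply]
  fin_cases i <;> fin_cases j <;> simp [emMat]

theorem emMat_zero : emMat 0 0 0 0 0 0 = 0 := by
  ext i j
  fin_cases i <;> fin_cases j <;> simp [emMat]

theorem genH_eq : genH = isoMat 0 0 0 0 0 0 1 0 0 0 := by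
  unfold genH genP isoMat algMat
  rw [emMat_zero]
  congr 1
  ext i j
  simp only [Matrix.replicateCol_apply, Matrix.neg_apply, eta, Matrix.diagonal_apply]
  fin_cases i <;> simp

theorem P1_eq : P1 = isoMat 0 0 0 0 0 0 0 (-1) 0 0 := by
  unfold P1 genP isoMat algMat
  rw [emMat_zero]
  congr 1
  ext i j
  simp only [Matrix.replicateCol_apply, Matrix.neg_apply, eta, Matrix.diagonal_apply]
  fin_cases i <;> simp

theorem formA_eq (a ω τ : ℝ) :
    formA a ω τ = isoMat (-(a * τ)) 0 0 (ω * τ) 0 0 τ 0 0 0 := by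
  unfold formA
  rw [K1_eq, J1_eq, genH_eq]
  simp only [isoMat_add, smul_isoMat]
  congr 1 <;> ring

theorem formB_eq (a ω τ : ℝ) :
    formB a ω τ = isoMat 0 (-(a * τ)) 0 0 0 (-(ω * τ)) τ 0 0 0 := by
  unfold formB
  rw [K2_eq, J3_eq, genH_eq, sub_eq_add_neg, ← neg_one_smul ℝ (ω • _)]
  simp only [isoMat_add, smul_isoMat]
  congr 1 <;> ring

theorem formC_eq (ε ω l : ℝ) :
    formC ε ω l = isoMat 0 0 0 (l * ω) 0 0 l (ε * l) 0 0 := by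
  unfold formC
  rw [P1_eq, J1_eq, genH_eq, sub_eq_add_neg, ← neg_one_smul ℝ (ε • _)]
  simp only [isoMat_add, smul_isoMat]
  congr 1 <;> ring

theorem formD_eq (h l : ℝ) :
    formD h l = isoMat 0 (-(l * h)) 0 0 0 (-(l * h)) l l 0 0 := by
  unfold formD
  rw [P1_eq, K2_eq, J3_eq, genH_eq, sub_eq_add_neg, sub_eq_add_neg,
    ← neg_one_smul ℝ (isoMat _ _ _ _ _ _ _ (-1) _ _), ← neg_one_smul ℝ (isoMat _ _ _ _ _ 1 _ _ _ _)]
  simp only [isoMat_add, smul_isoMat]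
  congr 1 <;> ring

theorem fieldMeets_orbit_iff {P : Vec4 → Prop} (hL : ∀ L ∈ SO13, ∀ v, P v → P (L.mulVec v))
    {X Y : Mat5} (hX : X ∈ iso13) (h : Y ∈ adOrbit X) : FieldMeets P Y ↔ FieldMeets P X :=
  ⟨FieldMeets.of_orbit hL hX h,
    FieldMeets.of_orbit hL (mem_iso13_of_mem_adOrbit hX h) (adOrbit_symm h)⟩

/-! ### The constants occurring in forms (a) and (b). -/

section forms
variable {X : Mat5} (hX : X ∈ iso13)
include hX

theorem invariants_of_formA {a ω τ : ℝ} (h : formA a ω τ ∈ adOrbit X) :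
    (a ^ 2 - ω ^ 2) * τ ^ 2 = -2 * I₁ X ∧ a * ω * τ ^ 2 = I₂ X := by
  obtain ⟨h1, h2, -⟩ := invariants_eq hX h
  rw [formA_eq, I₁_isoMat] at h1
  rw [formA_eq, I₂_isoMat] at h2
  constructor
  · rw [← h1]; ring
  · rw [← h2]; ring

theorem invariants_of_formB {a ω τ : ℝ} (h : formB a ω τ ∈ adOrbit X) :
    I₂ X = 0 ∧ (a ^ 2 - ω ^ 2) * τ ^ 2 = -2 * I₁ X ∧ ω ^ 2 * τ ^ 4 = I₃ X := by
  obtain ⟨h1, h2, h3⟩ := invariants_eq hX h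
  rw [formB_eq, I₁_isoMat] at h1
  rw [formB_eq, I₂_isoMat] at h2
  have h0 : I₂ X = 0 := by rw [← h2]; ring
  have h3 := h3 h0
  rw [formB_eq, I₃_isoMat] at h3
  refine ⟨h0, ?_, ?_⟩
  · rw [← h1]; ring
  · rw [← h3]; ring

theorem exists_parallel_frame (h : ¬ (I₁ X = 0 ∧ I₂ X = 0)) :
    ∃ φ θ w0 w1 w2 w3 : ℝ, φ ≤ 0 ∧ (φ = 0 → 0 ≤ θ) ∧
      isoMat φ 0 0 θ 0 0 w0 w1 w2 w3 ∈ adOrbit X ∧ θ ^ 2 - φ ^ 2 = 2 * I₁ X ∧ -(φ * θ) = I₂ X := by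
  obtain ⟨e1, e2, e3, b1, b2, b3, w0, w1, w2, w3, rfl⟩ := exists_isoMat hX
  obtain ⟨φ, θ, w0', w1', w2', w3', h1, h2, h3⟩ :=
    exists_frame_of_parallel (e1 := e1) (e2 := e2) (e3 := e3) (b1 := b1) (b2 := b2) (b3 := b3)
      w0 w1 w2 w3 (by
        rintro ⟨h3, h4⟩
        apply h
        rw [I₁_isoMat, I₂_isoMat]
        constructor <;> linarith)
  obtain ⟨i1, i2, -⟩ := invariants_eq hX h3
  refine ⟨φ, θ, w0', w1', w2', w3', h1, h2, h3, ?_, ?_⟩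
  · rw [← i1, I₁_isoMat]; ring
  · rw [← i2, I₂_isoMat]; ring

/-- Since I₂ = -φθ ≠ 0, the matrix F is invertible, and a translation brings w to (τ, 0, 0, 0) for
any τ. -/
theorem exists_formA (h : I₂ X ≠ 0) {τ : ℝ} (hτ : 0 < τ) : ∃ a ω, HasFormA X a ω τ := by
  obtain ⟨φ, θ, w0, w1, w2, w3, h1, -, h3, -, h5⟩ :=
    exists_parallel_frame hX (fun h' => h h'.2)
  have hφ : φ ≠ 0 := by rintro rfl; apply h; rw [← h5]; ring
  have hθ : θ ≠ 0 := by rintro rfl; apply h; rw [← h5]; ring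
  refine ⟨-φ / τ, θ / τ, div_pos (neg_pos.mpr (lt_of_le_of_ne h1 hφ)) hτ,
    div_ne_zero hθ hτ.ne', hτ, ?_⟩
  have := adOrbit_trans h3 (isoMat_translate _ _ _ _ _ _ _ _ _ _
    (-w1 / φ) ((τ - w0) / φ) (w3 / θ) (-w2 / θ))
  rw [formA_eq]
  convert this using 1
  congr 1 <;> field_simp <;> ring

/-- For given τ the two invariants determine (a + iω)², hence a + iω itself once a > 0. -/
theorem hasFormA_iff (h : I₂ X ≠ 0) {a ω τ : ℝ} (ha : 0 < a) (hτ : 0 < τ) :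
    HasFormA X a ω τ ↔ (a ^ 2 - ω ^ 2) * τ ^ 2 = -2 * I₁ X ∧ a * ω * τ ^ 2 = I₂ X := by
  refine ⟨fun h' => invariants_of_formA hX h'.2.2.2, fun ⟨h1, h2⟩ => ?_⟩
  obtain ⟨a', ω', h'⟩ := exists_formA hX h hτ
  obtain ⟨h3, h4⟩ := invariants_of_formA hX h'.2.2.2
  have ha' := h'.1
  have e1 : a ^ 2 - ω ^ 2 = a' ^ 2 - ω' ^ 2 :=
    mul_right_cancel₀ (pow_ne_zero 2 hτ.ne') (h1.trans h3.symm)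
  have e2 : a * ω = a' * ω' := mul_right_cancel₀ (pow_ne_zero 2 hτ.ne') (h2.trans h4.symm)
  have e3 : (a ^ 2 - a' ^ 2) * (a ^ 2 + ω' ^ 2) = 0 := by
    linear_combination a ^ 2 * e1 + (a * ω + a' * ω') * e2
  have e4 : a ^ 2 = a' ^ 2 := by
    have := (mul_eq_zero.mp e3).resolve_right (by positivity)
    linarith
  have e5 : a = a' := (sq_eq_sq₀ ha.le ha'.le).mp e4
  subst e5
  have e6 : ω = ω' := mul_left_cancel₀ ha.ne' e2
  subst e6
  exact h'

theorem exists_formB (h : I₂ X = 0) (hT : FieldMeets FDTimelike X) :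
    ∃ a ω τ, HasFormB X a ω τ := by
  obtain ⟨e1, e2, e3, b1, b2, b3, w0, w1, w2, w3, rfl⟩ := exists_isoMat hX
  obtain ⟨c0, c1, c2, c3, hc⟩ := (fieldMeets_isoMat _ _ _ _ _ _ _ _ _ _ _).mp hT
  rw [fdTimelike_vec_iff] at hc
  obtain ⟨e1', e2', e3', b1', b2', b3', τ, hτ, m⟩ := exists_rest_frame e1 e2 e3 b1 b2 b3 hc.2 hc.1
  have m1 := adOrbit_trans (isoMat_translate _ _ _ _ _ _ _ _ _ _ c0 c1 c2 c3) m
  have hp : e1' * b1' + e2' * b2' + e3' * b3' = 0 := by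
    have := (invariants_eq hX m1).2.1
    rw [h, I₂_isoMat] at this
    linarith
  obtain ⟨α, β, w1', w2', w3', hα, hβ, hw, m2⟩ := exists_frame_of_orthogonal τ 0 0 0 hp
  have z1 : w1' = 0 := by nlinarith [sq_nonneg w1', sq_nonneg w2', sq_nonneg w3']
  have z2 : w2' = 0 := by nlinarith [sq_nonneg w1', sq_nonneg w2', sq_nonneg w3']
  have z3 : w3' = 0 := by nlinarith [sq_nonneg w1', sq_nonneg w2', sq_nonneg w3']
  subst z1 z2 z3
  refine ⟨-α / τ, -β / τ, τ, div_nonneg (by linarith) hτ.le, div_nonneg (by linarith) hτ.le, hτ, ?_⟩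
  rw [formB_eq]
  convert adOrbit_trans m1 m2 using 1
  congr 1 <;> field_simp

omit hX in
/-- The forms (b) in the orbit of a given one. -/
theorem formB_mem_adOrbit_formB {a₀ ω₀ τ₀ a ω τ : ℝ} (ha₀ : 0 ≤ a₀) (hω₀ : 0 ≤ ω₀) (hτ₀ : 0 < τ₀)
    (ha : 0 ≤ a) (hω : 0 ≤ ω) (hτ : 0 < τ)
    (h1 : (a₀ ^ 2 - ω₀ ^ 2) * τ₀ ^ 2 = (a ^ 2 - ω ^ 2) * τ ^ 2)
    (h2 : ω₀ * τ₀ ^ 2 = ω * τ ^ 2) (h3 : a₀ = 0 → ω₀ = 0 → τ₀ = τ) :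
    formB a ω τ ∈ adOrbit (formB a₀ ω₀ τ₀) := by
  rw [formB_eq, formB_eq]
  by_cases h0 : a₀ = 0 ∧ ω₀ = 0
  · obtain ⟨rfl, rfl⟩ := h0
    have e := h3 rfl rfl
    subst e
    have hω' : ω = 0 := by
      have : ω * τ₀ ^ 2 = 0 := by rw [← h2]; ring
      exact (mul_eq_zero.mp this).resolve_right (by positivity)
    subst hω'
    have ha' : a = 0 := by
      have : a ^ 2 * τ₀ ^ 2 = 0 := by linarith
      exact pow_eq_zero_iff two_ne_zero |>.mp
        ((mul_eq_zero.mp this).resolve_right (by positivity))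
    subst ha'
    exact ⟨1, ⟨1, SO13_one, 0, groupMat_one_zero.symm⟩, by simp⟩
  -- A boost along the first axis, orthogonal to e and b, moves (a₀τ₀, ω₀τ₀) to (aτ, ωτ) along the
  -- hyperbola fixed by I₁.
  · obtain ⟨C, S, hCS, hC, hA, hB⟩ := exists_boost_transitive (A := a₀ * τ₀) (B := ω₀ * τ₀)
      (A' := a * τ) (B' := ω * τ) (by positivity) (by positivity) (by positivity) (by positivity)
      (by linarith) (by
        intro h
        have e : a₀ = ω₀ := mul_right_cancel₀ hτ₀.ne' h
        have hpos : 0 < ω₀ := lt_of_le_of_ne hω₀ fun h' => h0 ⟨e.trans h'.symm, h'.symm⟩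
        refine ⟨by positivity, ?_⟩
        have : 0 < ω * τ * τ := by
          have : 0 < ω₀ * τ₀ ^ 2 := by positivity
          linarith
        exact pos_of_mul_pos_left this hτ.le)
    have m1 := isoMat_boost01 0 (-(a₀ * τ₀)) 0 0 0 (-(ω₀ * τ₀)) τ₀ 0 0 0 hCS hC
    rw [show C * -(a₀ * τ₀) - S * -(ω₀ * τ₀) = -(a * τ) by linarith,
      show C * -(ω₀ * τ₀) - S * -(a₀ * τ₀) = -(ω * τ) by linarith] at m1
    -- A translation by c along the second axis must bring w back to (τ, 0, 0, 0): two equations for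
    -- one unknown. They are compatible because ωτ² = √I₃ is preserved.
    have hne : ∃ c, a * τ * c = C * τ₀ - τ ∧ ω * τ * c = -(S * τ₀) := by
      have hinv : C * (ω * τ) + S * (a * τ) = ω₀ * τ₀ := by
        rw [← hA, ← hB]
        linear_combination (ω₀ * τ₀) * hCS
      have hcons : (ω * τ) * (C * τ₀ - τ) + (a * τ) * (S * τ₀) = 0 := by
        linear_combination τ₀ * hinv + h2
      by_cases hω0 : ω = 0
      · have ha0 : a ≠ 0 := by
          rintro rfl
          apply h0
          have e : ω₀ = 0 := by
            have : ω₀ * τ₀ ^ 2 = 0 := by rw [h2, hω0]; ring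
            exact (mul_eq_zero.mp this).resolve_right (by positivity)
          refine ⟨?_, e⟩
          have : a₀ ^ 2 * τ₀ ^ 2 = 0 := by rw [e, hω0] at h1; linarith
          exact pow_eq_zero_iff two_ne_zero |>.mp
            ((mul_eq_zero.mp this).resolve_right (by positivity))
        refine ⟨(C * τ₀ - τ) / (a * τ), by field_simp, ?_⟩
        have : a * τ * (S * τ₀) = 0 := by rw [hω0] at hcons; linarith
        have := (mul_eq_zero.mp this).resolve_left (mul_ne_zero ha0 hτ.ne')
        rw [hω0, this]
        ring
      · refine ⟨-(S * τ₀) / (ω * τ), ?_, by field_simp⟩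
        field_simp
        apply mul_right_cancel₀ hτ.ne'
        linarith
    obtain ⟨c, hc1, hc2⟩ := hne
    have m2 := adOrbit_trans m1 (isoMat_translate _ _ _ _ _ _ _ _ _ _ 0 0 c 0)
    convert m2 using 1
    congr 1 <;> linarith

/-- I₁ and I₃ fix the triple up to the family of `formB_mem_adOrbit_formB`. If both vanish, then a =
ω = 0 and F = 0, and the length of w is the remaining invariant. -/
theorem hasFormB_iff (h : I₂ X = 0) (hT : FieldMeets FDTimelike X) {a ω τ : ℝ}
    (ha : 0 ≤ a) (hω : 0 ≤ ω) (hτ : 0 < τ) :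
    HasFormB X a ω τ ↔ (a ^ 2 - ω ^ 2) * τ ^ 2 = -2 * I₁ X ∧ ω ^ 2 * τ ^ 4 = I₃ X ∧
      (I₁ X = 0 → I₃ X = 0 → τ ^ 2 = -I₄ X) := by
  have forward : ∀ {a ω τ : ℝ}, HasFormB X a ω τ →
      (a ^ 2 - ω ^ 2) * τ ^ 2 = -2 * I₁ X ∧ ω ^ 2 * τ ^ 4 = I₃ X ∧
      (I₁ X = 0 → I₃ X = 0 → τ ^ 2 = -I₄ X) := by
    rintro a ω τ ⟨ha, hω, hτ, hm⟩
    obtain ⟨-, h1, h2⟩ := invariants_of_formB hX hm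
    refine ⟨h1, h2, fun z1 z3 => ?_⟩
    rw [z3] at h2
    have e1 : ω = 0 := pow_eq_zero_iff two_ne_zero |>.mp
      ((mul_eq_zero.mp h2).resolve_right (by positivity))
    rw [z1, e1] at h1
    have e2 : a = 0 := by
      have : a ^ 2 * τ ^ 2 = 0 := by linarith
      exact pow_eq_zero_iff two_ne_zero |>.mp
        ((mul_eq_zero.mp this).resolve_right (by positivity))
    have hl : linPart (formB a ω τ) = 0 := by
      rw [formB_eq, linPart_isoMat_eq_zero, e1, e2]
      simp
    have hl' := (linPart_eq_zero_iff_of_orbit hX hm).mp hl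
    rw [← I₄_conj_of_linPart_eq_zero hX hm hl', I₄_eq_of_linPart_eq_zero hl, formB_eq, isoMat,
      transPart_algMat, ip_eq]
    simp only [Matrix.cons_val]
    ring
  refine ⟨forward, fun ⟨h1, h2, h3⟩ => ⟨ha, hω, hτ, ?_⟩⟩
  obtain ⟨a₀, ω₀, τ₀, h'⟩ := exists_formB hX h hT
  obtain ⟨h4, h5, h6⟩ := forward h'
  obtain ⟨ha₀, hω₀, hτ₀, hm⟩ := h'
  refine adOrbit_trans hm (formB_mem_adOrbit_formB ha₀ hω₀ hτ₀ ha hω hτ (h4.trans h1.symm) ?_ ?_)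
  · refine (sq_eq_sq₀ (by positivity) (by positivity)).mp ?_
    linear_combination h5 - h2
  · intro z1 z2
    have i1 : I₁ X = 0 := by rw [z1, z2] at h4; linarith
    have i3 : I₃ X = 0 := by rw [← h5, z2]; ring
    exact (sq_eq_sq₀ hτ₀.le hτ.le).mp ((h6 i1 i3).trans (h3 i1 i3).symm)

theorem formB_of_I₁_pos (h : I₂ X = 0) (hT : FieldMeets FDTimelike X) (h1 : 0 < I₁ X) :
    0 < I₃ X ∧ ∃ τ : ℝ, HasFormB X 0 (2 * I₁ X / √(I₃ X)) τ := by
  obtain ⟨a, ω, τ, h'⟩ := exists_formB hX h hT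
  obtain ⟨-, h2, h3⟩ := invariants_of_formB hX h'.2.2.2
  have hτ := h'.2.2.1
  have hω : ω ≠ 0 := by
    rintro rfl
    nlinarith [mul_nonneg (sq_nonneg a) (sq_nonneg τ)]
  have h3pos : 0 < I₃ X := by
    rw [← h3]
    positivity
  have hr := Real.sqrt_pos.mpr h3pos
  have hs := Real.sq_sqrt h3pos.le
  -- With a = 0 the equations are ω²τ² = 2I₁ and ω²τ⁴ = I₃, so τ² = I₃/(2I₁).
  refine ⟨h3pos, √(I₃ X / (2 * I₁ X)), ?_⟩
  have hp : 0 < I₃ X / (2 * I₁ X) := by positivity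
  have ht := Real.sq_sqrt hp.le
  rw [hasFormB_iff hX h hT le_rfl (by positivity) (Real.sqrt_pos.mpr hp)]
  refine ⟨?_, ?_, fun h0 => absurd h0 h1.ne'⟩
  · rw [ht, div_pow, hs]
    field_simp
    ring
  · rw [show √(I₃ X / (2 * I₁ X)) ^ 4 = (√(I₃ X / (2 * I₁ X)) ^ 2) ^ 2 by ring, ht, div_pow, hs]
    field_simp

/-- Vanishing invariants force a = ω = 0 in form (b). Without a timelike representative this fails:
form (d) has vanishing invariants and F ≠ 0. -/
theorem invariants_eq_zero_iff (hT : FieldMeets FDTimelike X) :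
    (I₁ X = 0 ∧ I₂ X = 0 ∧ I₃ X = 0) ↔ linPart X = 0 := by
  constructor
  · rintro ⟨h1, h2, h3⟩
    obtain ⟨a, ω, τ, -, -, hτ, hm⟩ := exists_formB hX h2 hT
    obtain ⟨-, h4, h5⟩ := invariants_of_formB hX hm
    rw [h3] at h5
    have e1 : ω = 0 := pow_eq_zero_iff two_ne_zero |>.mp
      ((mul_eq_zero.mp h5).resolve_right (by positivity))
    rw [h1, e1] at h4
    have e2 : a = 0 := by
      have : a ^ 2 * τ ^ 2 = 0 := by linarith
      exact pow_eq_zero_iff two_ne_zero |>.mp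
        ((mul_eq_zero.mp this).resolve_right (by positivity))
    rw [← linPart_eq_zero_iff_of_orbit hX hm, formB_eq, linPart_isoMat_eq_zero, e1, e2]
    simp
  · intro h
    obtain ⟨e1, e2, e3, b1, b2, b3, w0, w1, w2, w3, rfl⟩ := exists_isoMat hX
    obtain ⟨rfl, rfl, rfl, rfl, rfl, rfl⟩ := (linPart_isoMat_eq_zero _ _ _ _ _ _ _ _ _ _).mp h
    rw [I₁_isoMat, I₂_isoMat, I₃_isoMat]
    norm_num

theorem isPureRotation_iff (hT : FieldMeets FDTimelike X) :
    IsPureRotation X ↔ (I₂ X = 0 ∧ 0 < I₁ X) ∨ (I₁ X = 0 ∧ I₂ X = 0 ∧ I₃ X = 0) := by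
  constructor
  · rintro ⟨ω, τ, h⟩
    obtain ⟨h1, h2, h3⟩ := invariants_of_formB hX h.2.2.2
    have hτ := h.2.2.1
    by_cases hω : ω = 0
    · subst hω
      exact Or.inr ⟨by linarith, h1, by rw [← h3]; ring⟩
    · left
      refine ⟨h1, ?_⟩
      have : 0 < ω ^ 2 * τ ^ 2 := by positivity
      linarith
  · rintro (⟨h2, h1⟩ | ⟨h1, h2, h3⟩)
    · obtain ⟨-, τ, h⟩ := formB_of_I₁_pos hX h2 hT h1
      exact ⟨_, τ, h⟩
    · obtain ⟨a, ω, τ, h⟩ := exists_formB hX h2 hT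
      obtain ⟨-, h4, h5⟩ := invariants_of_formB hX h.2.2.2
      have hτ := h.2.2.1
      rw [h3] at h5
      have e1 : ω = 0 := pow_eq_zero_iff two_ne_zero |>.mp
        ((mul_eq_zero.mp h5).resolve_right (by positivity))
      rw [h1, e1] at h4
      have e2 : a = 0 := by
        have : a ^ 2 * τ ^ 2 = 0 := by linarith
        exact pow_eq_zero_iff two_ne_zero |>.mp
          ((mul_eq_zero.mp this).resolve_right (by positivity))
      subst e2
      exact ⟨ω, τ, h⟩

/-- For I₂ = 0 the equations give ω = √I₃/τ² and a² = ω² - 2I₁/τ², solvable for every τ because I₁ ≤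
0 away from pure rotations. For I₂ ≠ 0 form (a) exists for every τ. -/
theorem exists_unique_moduli (hT : FieldMeets FDTimelike X) (hR : ¬ IsPureRotation X) {τ : ℝ}
    (hτ : 0 < τ) : ∃ a ω : ℝ, (HasFormA X a ω τ ∨ HasFormB X a ω τ) ∧
      ∀ a' ω' : ℝ, (HasFormA X a' ω' τ ∨ HasFormB X a' ω' τ) → a' = a ∧ |ω'| = |ω| := by
  by_cases h2 : I₂ X = 0
  · rw [isPureRotation_iff hX hT] at hR
    have h1 : I₁ X ≤ 0 := by
      by_contra h
      exact hR (Or.inl ⟨h2, not_le.mp h⟩)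
    have h3 : 0 ≤ I₃ X := by
      obtain ⟨a, ω, τ, h⟩ := exists_formB hX h2 hT
      rw [← (invariants_of_formB hX h.2.2.2).2.2]
      positivity
    have hr := Real.sq_sqrt h3
    have hp : 0 ≤ (√(I₃ X) / τ ^ 2) ^ 2 - 2 * I₁ X / τ ^ 2 := by
      have : 0 ≤ -(2 * I₁ X / τ ^ 2) := by
        rw [← neg_div]
        exact div_nonneg (by linarith) (by positivity)
      have := sq_nonneg (√(I₃ X) / τ ^ 2)
      linarith
    have hB : HasFormB X (√((√(I₃ X) / τ ^ 2) ^ 2 - 2 * I₁ X / τ ^ 2)) (√(I₃ X) / τ ^ 2) τ := by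
      rw [hasFormB_iff hX h2 hT (Real.sqrt_nonneg _) (by positivity) hτ, Real.sq_sqrt hp]
      refine ⟨?_, ?_, fun z1 z3 => absurd (Or.inr ⟨z1, h2, z3⟩) hR⟩
      · field_simp
        ring
      · rw [div_pow, hr]
        field_simp
    refine ⟨_, _, Or.inr hB, ?_⟩
    rintro a' ω' (h' | h')
    · exfalso
      have := (invariants_of_formA hX h'.2.2.2).2
      rw [h2] at this
      have h4 := h'.1
      have h5 := h'.2.1
      have : a' * ω' * τ ^ 2 ≠ 0 := mul_ne_zero (mul_ne_zero h4.ne' h5) (pow_ne_zero 2 hτ.ne')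
      contradiction
    · obtain ⟨-, i1, i3⟩ := invariants_of_formB hX h'.2.2.2
      obtain ⟨-, j1, j3⟩ := invariants_of_formB hX hB.2.2.2
      have e1 : ω' ^ 2 = (√(I₃ X) / τ ^ 2) ^ 2 :=
        mul_right_cancel₀ (pow_ne_zero 4 hτ.ne') (i3.trans j3.symm)
      have e2 := mul_right_cancel₀ (pow_ne_zero 2 hτ.ne') (i1.trans j1.symm)
      refine ⟨(sq_eq_sq₀ h'.1 hB.1).mp (by linarith), (sq_eq_sq_iff_abs_eq_abs _ _).mp e1⟩
  · obtain ⟨a, ω, hA⟩ := exists_formA hX h2 hτ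
    refine ⟨a, ω, Or.inl hA, ?_⟩
    obtain ⟨j1, j2⟩ := invariants_of_formA hX hA.2.2.2
    rintro a' ω' (h' | h')
    · obtain ⟨i1, i2⟩ := invariants_of_formA hX h'.2.2.2
      have e1 := mul_right_cancel₀ (pow_ne_zero 2 hτ.ne') (i1.trans j1.symm)
      have e2 := mul_right_cancel₀ (pow_ne_zero 2 hτ.ne') (i2.trans j2.symm)
      have ha := hA.1
      have e3 : (a' ^ 2 - a ^ 2) * (a' ^ 2 + ω ^ 2) = 0 := by
        linear_combination a' ^ 2 * e1 + (a' * ω' + a * ω) * e2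
      have e4 : a' ^ 2 = a ^ 2 := by
        have ha' := h'.1
        have := (mul_eq_zero.mp e3).resolve_right (by positivity)
        linarith
      have e5 : a' = a := (sq_eq_sq₀ h'.1.le ha.le).mp e4
      refine ⟨e5, ?_⟩
      rw [e5] at e2
      rw [mul_left_cancel₀ ha.ne' e2]
    · exact absurd (invariants_of_formB hX h'.2.2.2).1 h2

/-! ### Orbits that are causal but not timelike -/

theorem I₂_eq_zero_of_not_timelike (hT : ¬ FieldMeets FDTimelike X) : I₂ X = 0 := by
  by_contra h
  obtain ⟨a, ω, h'⟩ := exists_formA hX h one_pos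
  apply hT
  rw [← fieldMeets_orbit_iff (fun L hL v => FDTimelike.mulVec hL) hX h'.2.2.2, formA_eq,
    fieldMeets_isoMat]
  refine ⟨0, 0, 0, 0, ?_⟩
  rw [fdTimelike_vec_iff]
  norm_num

theorem hasFormC_of_frame {θ w0 w1 : ℝ} (hθ : 0 ≤ θ) (hw0 : 0 < w0) (hw1 : w1 ^ 2 = w0 ^ 2)
    (hm : isoMat 0 0 0 θ 0 0 w0 w1 0 0 ∈ adOrbit X) :
    ∃ ε₂ : ℝ, (ε₂ = 1 ∨ ε₂ = -1) ∧ (∃ ω l : ℝ, HasFormC X ε₂ ω l) ∧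
      ∀ ω l : ℝ, 0 ≤ ω → 0 < l → (HasFormC X ε₂ ω l ↔ l * ω = √(2 * I₁ X)) := by
  have hI : 2 * I₁ X = θ ^ 2 := by
    rw [← (invariants_eq hX hm).1, I₁_isoMat]; ring
  have hr : √(2 * I₁ X) = θ := by rw [hI, Real.sqrt_sq hθ]
  obtain ⟨ε, hε, rfl⟩ : ∃ ε : ℝ, (ε = 1 ∨ ε = -1) ∧ w1 = ε * w0 := by
    rcases sq_eq_sq_iff_eq_or_eq_neg.mp hw1 with h | h
    · exact ⟨1, Or.inl rfl, by linarith⟩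
    · exact ⟨-1, Or.inr rfl, by linarith⟩
  have hε2 : ε * ε = 1 := by rcases hε with rfl | rfl <;> norm_num
  have hiff : ∀ ω l : ℝ, 0 ≤ ω → 0 < l → (HasFormC X ε ω l ↔ l * ω = √(2 * I₁ X)) := by
    intro ω l hω hl
    constructor
    · rintro ⟨-, -, h⟩
      have := (invariants_eq hX h).1
      rw [formC_eq, I₁_isoMat] at this
      rw [show 2 * I₁ X = (l * ω) ^ 2 by rw [← this]; ring, Real.sqrt_sq (by positivity)]
    · intro h
      rw [hr] at h
      refine ⟨hω, hl, adOrbit_trans hm ?_⟩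
      obtain ⟨C, S, hCS, hC, hk, -⟩ := exists_boost_scale (div_pos hl hw0)
      -- The boost is directed along the null vector (1, ε, 0, 0), which it scales by C - S; the
      -- rotation in the 23-plane is unaffected.
      have hCS' : C ^ 2 - (ε * S) ^ 2 = 1 := by linear_combination hCS - S ^ 2 * hε2
      have hk' : (C - S) * w0 = l := by rw [hk]; field_simp
      have m := isoMat_boost01 0 0 0 θ 0 0 w0 (ε * w0) 0 0 hCS' hC
      rw [formC_eq]
      convert m using 1
      congr 1
      · ring
      · ring
      · ring
      · ring
      · linear_combination -hk' + S * w0 * hε2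
      · linear_combination -ε * hk'
  exact ⟨ε, hε, ⟨√(2 * I₁ X), 1, (hiff _ _ (Real.sqrt_nonneg _) one_pos).mpr (one_mul _)⟩, hiff⟩

theorem causal_of_I₁_ne_zero (hC : FieldMeets FDCausal X) (hT : ¬ FieldMeets FDTimelike X)
    (h1 : I₁ X ≠ 0) : 0 < I₁ X ∧ ∃ θ w0 w1 : ℝ, 0 ≤ θ ∧ 0 < w0 ∧ w1 ^ 2 = w0 ^ 2 ∧
      isoMat 0 0 0 θ 0 0 w0 w1 0 0 ∈ adOrbit X := by
  have h2 := I₂_eq_zero_of_not_timelike hX hT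
  obtain ⟨φ, θ, w0, w1, w2, w3, hφ, hθ, hm, i1, i2⟩ :=
    exists_parallel_frame hX (fun h' => h1 h'.1)
  rw [← fieldMeets_orbit_iff (fun L hL v => FDTimelike.mulVec hL) hX hm, fieldMeets_isoMat] at hT
  rw [← fieldMeets_orbit_iff (fun L hL v => FDCausal.mulVec hL) hX hm, fieldMeets_isoMat] at hC
  simp only [fdTimelike_vec_iff] at hT
  simp only [fdCausal_vec_iff] at hC
  have hφ0 : φ = 0 := by
    by_contra hne
    have hθ0 : θ = 0 := by
      rw [h2] at i2
      exact (mul_eq_zero.mp (neg_eq_zero.mp i2)).resolve_left hne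
    subst hθ0
    apply hT
    -- F is a boost generator, so w0 and w1 are free: w1 is removed and w0 is made larger than the
    -- spatial length.
    refine ⟨-w1 / φ, (1 + w2 ^ 2 + w3 ^ 2 - w0) / φ, 0, 0, ?_⟩
    rw [show w0 + (φ * ((1 + w2 ^ 2 + w3 ^ 2 - w0) / φ) + 0 * 0 + 0 * 0) = 1 + w2 ^ 2 + w3 ^ 2 by
      field_simp; ring, show w1 + (φ * (-w1 / φ) + 0 * 0 - 0 * 0) = 0 by field_simp; ring]
    constructor
    · nlinarith [sq_nonneg w2, sq_nonneg w3, sq_nonneg (w2 ^ 2), sq_nonneg (w3 ^ 2),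
        mul_nonneg (sq_nonneg w2) (sq_nonneg w3)]
    · positivity
  subst hφ0
  have hθ' := hθ rfl
  have hθ0 : θ ≠ 0 := by
    rintro rfl
    apply h1
    linarith
  have hθpos : 0 < θ := lt_of_le_of_ne hθ' (Ne.symm hθ0)
  refine ⟨by nlinarith, θ, w0, w1, hθ', ?_⟩
  obtain ⟨c0, c1, c2, c3, hc1, hc2⟩ := hC
  simp only [zero_mul, add_zero, sub_zero] at hc1 hc2
  refine ⟨hc2, ?_, ?_⟩
  · by_contra hne
    apply hT
    -- F changes only w2 and w3. With these removed, w0² > w1² would give a timelike representative.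
    refine ⟨0, 0, w3 / θ, -w2 / θ, ?_, by simpa using hc2⟩
    have e2 : w2 + (0 * 0 - 0 * 0 + θ * (-w2 / θ)) = 0 := by field_simp; ring
    have e3 : w3 + (0 * 0 + 0 * 0 - θ * (w3 / θ)) = 0 := by field_simp; ring
    rw [e2, e3]
    simp only [zero_mul, add_zero, sub_zero]
    have : w1 ^ 2 ≤ w0 ^ 2 := by
      nlinarith [sq_nonneg (w2 + (0 + θ * c3)), sq_nonneg (w3 + (0 - θ * c2)),
        sq_nonneg (w2 + θ * c3), sq_nonneg (w3 + -(θ * c2)), sq_nonneg (w3 - θ * c2)]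
    have := lt_of_le_of_ne this hne
    linarith
  · have := adOrbit_trans hm (isoMat_translate _ _ _ _ _ _ _ _ _ _ 0 0 (w3 / θ) (-w2 / θ))
    convert this using 1
    congr 1 <;> field_simp <;> ring

theorem causal_of_linPart_eq_zero (hC : FieldMeets FDCausal X) (hT : ¬ FieldMeets FDTimelike X)
    (h0 : linPart X = 0) : ∃ w0 w1 : ℝ, 0 < w0 ∧ w1 ^ 2 = w0 ^ 2 ∧
      isoMat 0 0 0 0 0 0 w0 w1 0 0 ∈ adOrbit X := by
  obtain ⟨e1, e2, e3, b1, b2, b3, w0, w1, w2, w3, rfl⟩ := exists_isoMat hX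
  obtain ⟨rfl, rfl, rfl, rfl, rfl, rfl⟩ := (linPart_isoMat_eq_zero _ _ _ _ _ _ _ _ _ _).mp h0
  rw [fieldMeets_isoMat] at hC hT
  simp only [zero_mul, add_zero, sub_zero] at hC hT
  obtain ⟨-, -, -, -, hC⟩ := hC
  simp only [exists_const, fdTimelike_vec_iff] at hT
  rw [fdCausal_vec_iff] at hC
  have hn : w1 ^ 2 + w2 ^ 2 + w3 ^ 2 = w0 ^ 2 := by
    by_contra hne
    exact hT ⟨lt_of_le_of_ne hC.1 hne, hC.2⟩
  obtain ⟨c, s, hcs, hk, -⟩ := exists_rotation_second w2 w3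
  have m1 := isoMat_rotate23 0 0 0 0 0 0 w0 w1 w2 w3 hcs
  have hv : (c * w2 + s * w3) ^ 2 = w2 ^ 2 + w3 ^ 2 := by
    linear_combination (w2 ^ 2 + w3 ^ 2) * hcs - (-s * w2 + c * w3) * hk
  rw [hk] at m1
  generalize c * w2 + s * w3 = v at m1 hv
  obtain ⟨c', s', hcs', hk', -⟩ := exists_rotation_second w1 v
  have m2 := adOrbit_trans m1 (isoMat_rotate12 _ _ _ _ _ _ _ _ _ _ hcs')
  have hu : (c' * w1 + s' * v) ^ 2 = w1 ^ 2 + v ^ 2 := by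
    linear_combination (w1 ^ 2 + v ^ 2) * hcs' - (-s' * w1 + c' * v) * hk'
  rw [hk'] at m2
  simp only [mul_zero, add_zero] at m2
  exact ⟨w0, _, hC.2, by linarith, m2⟩

theorem hasFormD_of_null (hC : FieldMeets FDCausal X) (hT : ¬ FieldMeets FDTimelike X)
    (h1 : I₁ X = 0) (h0 : linPart X ≠ 0) {h l : ℝ} (hh : h ≠ 0) (hl : 0 < l) :
    HasFormD X h l := by
  have h2 := I₂_eq_zero_of_not_timelike hX hT
  obtain ⟨α, w0, w1, w2, w3, hα, hm⟩ : ∃ α w0 w1 w2 w3 : ℝ, α ≤ 0 ∧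
      isoMat 0 α 0 0 0 α w0 w1 w2 w3 ∈ adOrbit X := by
    obtain ⟨e1, e2, e3, b1, b2, b3, w0, w1, w2, w3, rfl⟩ := exists_isoMat hX
    have hp : e1 * b1 + e2 * b2 + e3 * b3 = 0 := by
      rw [I₂_isoMat] at h2
      linarith
    obtain ⟨α, β, w1', w2', w3', hα, hβ, -, hm⟩ := exists_frame_of_orthogonal w0 w1 w2 w3 hp
    have i1 := (invariants_eq hX hm).1
    rw [h1, I₁_isoMat] at i1
    have hsq : (-α) ^ 2 = (-β) ^ 2 := by linarith
    have e : α = β := by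
      have := (sq_eq_sq₀ (by linarith) (by linarith)).mp hsq
      linarith
    subst e
    exact ⟨α, w0, w1', w2', w3', hα, hm⟩
  have hα0 : α ≠ 0 := by
    rintro rfl
    apply h0
    rw [← linPart_eq_zero_iff_of_orbit hX hm, linPart_isoMat_eq_zero]
    simp
  rw [← fieldMeets_orbit_iff (fun L hL v => FDTimelike.mulVec hL) hX hm, fieldMeets_isoMat] at hT
  rw [← fieldMeets_orbit_iff (fun L hL v => FDCausal.mulVec hL) hX hm, fieldMeets_isoMat] at hC
  simp only [fdTimelike_vec_iff, zero_mul, add_zero, zero_add, sub_zero] at hT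
  simp only [fdCausal_vec_iff, zero_mul, add_zero, zero_add, sub_zero] at hC
  obtain ⟨c0, c1, c2, c3, hc1, hc2⟩ := hC
  -- Im F is spanned by the null vector (1, 1, 0, 0) and e₂, so w0 - w1 and w3 are constant on the
  -- class. Causality gives w0 - w1 ≥ 0, and a positive value would produce a timelike
  -- representative.
  have hκ : w0 = w1 := by
    by_contra hne
    have hpos : 0 < w0 - w1 := by
      have hsq : (w1 + α * c2) ^ 2 ≤ (w0 + α * c2) ^ 2 := by
        nlinarith [sq_nonneg (w2 + (α * c0 - α * c1)), sq_nonneg w3]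
      have := abs_le_of_sq_le_sq' hsq hc2.le
      exact lt_of_le_of_ne (by linarith [this.2]) (fun h => hne (by linarith))
    set κ := w0 - w1 with hκ
    -- move along the null direction until the square is negative
    apply hT
    -- With time component s the first two components contribute s² - (s - κ)² = 2κs - κ² = 2 + 2w3²
    -- + κ², which exceeds w3².
    set s := (1 + w3 ^ 2) / κ + κ with hs
    have hspos : 0 < s := by positivity
    refine ⟨-w2 / α, 0, (s - w0) / α, 0, ?_⟩
    have e0 : w0 + α * ((s - w0) / α) = s := by field_simp; ring
    have e1 : w1 + α * ((s - w0) / α) = s - κ := by rw [hκ]; field_simp; ring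
    have e2 : w2 + (α * (-w2 / α) - α * 0) = 0 := by field_simp; ring
    rw [e0, e1, e2]
    refine ⟨?_, hspos⟩
    have : κ * s = 1 + w3 ^ 2 + κ ^ 2 := by rw [hs]; field_simp
    nlinarith [sq_nonneg w3, sq_nonneg κ]
  subst hκ
  have hw3 : w3 = 0 := by
    nlinarith [sq_nonneg (w2 + (α * c0 - α * c1)), sq_nonneg w3]
  subst hw3
  refine ⟨hh, hl, adOrbit_trans hm ?_⟩
  have hαneg : α < 0 := lt_of_le_of_ne hα hα0
  obtain ⟨C, S, hCS, hC, hk, -⟩ :=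
    exists_boost_scale (k := l * |h| / -α) (div_pos (by positivity) (by linarith))
  have m1 := isoMat_boost01 0 α 0 0 0 α w0 w0 w2 0 hCS hC
  have e : C * α - S * α = -(l * |h|) := by
    have : (C - S) * α = -(l * |h|) := by rw [hk]; field_simp
    linarith
  rw [e] at m1
  -- The boost adjusts only the size of F; a half-turn in the 23-plane supplies the sign of h.
  obtain ⟨σ, hσ, hσh⟩ : ∃ σ : ℝ, σ ^ 2 + 0 ^ 2 = 1 ∧ σ * |h| = h := by
    rcases abs_choice h with h' | h'
    · exact ⟨1, by norm_num, by rw [h']; ring⟩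
    · exact ⟨-1, by norm_num, by rw [h']; ring⟩
  have m2 := adOrbit_trans m1 (isoMat_rotate23 _ _ _ _ _ _ _ _ _ _ hσ)
  have e' : σ * -(l * |h|) = -(l * h) := by linear_combination -l * hσh
  simp only [mul_zero, add_zero, zero_mul, neg_zero, zero_add, e'] at m2
  -- The translation removes w2 and slides w along the null direction until w0 = w1 = l.
  have m3 := adOrbit_trans m2 (isoMat_translate _ _ _ _ _ _ _ _ _ _
    (σ * w2 / (l * h)) 0 ((C * w0 - S * w0 - l) / (l * h)) 0)
  rw [formD_eq]
  convert m3 using 1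
  congr 1 <;> field_simp <;> ring

end forms

end MinkowskiSpace

open MinkowskiSpace

/-- Relativistic Chasles' theorem, causal Lie cone version. The first two clauses relate the
hypotheses on the flow to the orbit formulation; the third is the timelike part; the fourth is the
part about orbits that are causal but not timelike. -/
theorem theorem4p11 (X : Mat5) (hX : X ∈ iso13) :
    (MovesToTimelikeFuture X ↔ ∃ Y ∈ adOrbit X, Y ∈ lnI) ∧
    (MovesToCausalFuture X ↔
      ∃ Y ∈ adOrbit X, Y ∈ lnJ ∧ transPart (NormedSpace.exp Y) ≠ 0) ∧
    (X ≠ 0 → MovesToTimelikeFuture X →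
      -- normal form (a), and which constants occur in it
      (I₂ X ≠ 0 →
        (∃ a ω τ : ℝ, HasFormA X a ω τ) ∧
        ∀ a ω τ : ℝ, 0 < a → ω ≠ 0 → 0 < τ →
          (HasFormA X a ω τ ↔
            (a ^ 2 - ω ^ 2) * τ ^ 2 = -2 * I₁ X ∧ a * ω * τ ^ 2 = I₂ X)) ∧
      -- normal form (b), and which constants occur in it
      (I₂ X = 0 →
        (∃ a ω τ : ℝ, HasFormB X a ω τ) ∧
        (∀ a ω τ : ℝ, 0 ≤ a → 0 ≤ ω → 0 < τ →
          (HasFormB X a ω τ ↔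
            (a ^ 2 - ω ^ 2) * τ ^ 2 = -2 * I₁ X ∧ ω ^ 2 * τ ^ 4 = I₃ X ∧
            (I₁ X = 0 → I₃ X = 0 → τ ^ 2 = -I₄ X))) ∧
        (I₁ X ≤ 0 → ∃ a ω τ : ℝ, HasFormB X a ω τ ∧ ω ≤ a) ∧
        (0 < I₁ X → 0 < I₃ X ∧ ∃ τ : ℝ, HasFormB X 0 (2 * I₁ X / √(I₃ X)) τ)) ∧
      ((I₁ X = 0 ∧ I₂ X = 0 ∧ I₃ X = 0) ↔ linPart X = 0) ∧
      -- pure rotation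
      (IsPureRotation X ↔
        (I₂ X = 0 ∧ 0 < I₁ X) ∨ (I₁ X = 0 ∧ I₂ X = 0 ∧ I₃ X = 0)) ∧
      -- otherwise the duration is arbitrary, and it determines the two moduli
      (¬ IsPureRotation X → ∀ τ : ℝ, 0 < τ →
        ∃ a ω : ℝ, (HasFormA X a ω τ ∨ HasFormB X a ω τ) ∧
          ∀ a' ω' : ℝ, (HasFormA X a' ω' τ ∨ HasFormB X a' ω' τ) →
            a' = a ∧ |ω'| = |ω|)) ∧
    (MovesToCausalFuture X → ¬ MovesToTimelikeFuture X →
      0 ≤ I₁ X ∧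
      -- normal form (c), and which constants occur in it
      ((0 < I₁ X ∨ linPart X = 0) →
        ∃ ε₂ : ℝ, (ε₂ = 1 ∨ ε₂ = -1) ∧
          (∃ ω l : ℝ, HasFormC X ε₂ ω l) ∧
          ∀ ω l : ℝ, 0 ≤ ω → 0 < l → (HasFormC X ε₂ ω l ↔ l * ω = √(2 * I₁ X))) ∧
      -- normal form (d), with arbitrary constants
      (I₁ X = 0 ∧ linPart X ≠ 0 → ∀ h l : ℝ, h ≠ 0 → 0 < l → HasFormD X h l)) := by
  rw [movesToTimelikeFuture_iff hX, movesToCausalFuture_iff hX]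
  refine ⟨?_, ?_, fun _ hT => ⟨fun h2 => ⟨?_, fun a ω τ ha _ hτ => hasFormA_iff hX h2 ha hτ⟩,
    fun h2 => ⟨exists_formB hX h2 hT, fun a ω τ ha hω hτ => hasFormB_iff hX h2 hT ha hω hτ,
      fun h1 => ?_, formB_of_I₁_pos hX h2 hT⟩, invariants_eq_zero_iff hX hT,
    isPureRotation_iff hX hT, fun hR τ hτ => exists_unique_moduli hX hT hR hτ⟩,
    fun hC hT => ⟨?_, ?_, fun ⟨h1, h0⟩ h l hh hl => hasFormD_of_null hX hC hT h1 h0 hh hl⟩⟩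
  · rw [← movesToTimelikeFuture_iff hX, movesToTimelikeFuture_iff_lnI hX]
  · rw [← movesToCausalFuture_iff hX, movesToCausalFuture_iff_lnJ hX]
  · obtain ⟨a, ω, h⟩ := exists_formA hX h2 one_pos
    exact ⟨a, ω, 1, h⟩
  · obtain ⟨a, ω, τ, h⟩ := exists_formB hX h2 hT
    refine ⟨a, ω, τ, h, ?_⟩
    obtain ⟨-, h3, -⟩ := invariants_of_formB hX h.2.2.2
    obtain ⟨ha, hω, hτ, -⟩ := h
    have : 0 ≤ a ^ 2 - ω ^ 2 :=
      nonneg_of_mul_nonneg_left (by linarith : 0 ≤ (a ^ 2 - ω ^ 2) * τ ^ 2) (by positivity)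
    exact (sq_le_sq₀ hω ha).mp (by linarith)
  · by_cases h1 : I₁ X = 0
    · exact h1.ge
    · exact (causal_of_I₁_ne_zero hX hC hT h1).1.le
  · rintro (h1 | h0)
    · obtain ⟨-, θ, w0, w1, hθ, hw0, hw1, hm⟩ := causal_of_I₁_ne_zero hX hC hT h1.ne'
      exact hasFormC_of_frame hX hθ hw0 hw1 hm
    · obtain ⟨w0, w1, hw0, hw1, hm⟩ := causal_of_linPart_eq_zero hX hC hT h0
      exact hasFormC_of_frame hX le_rfl hw0 hw1 hm
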